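/- Let $n\ge 1$ and identify $\mathbb{H}^n$ with $\mathbb{R}^{4n}$ by $q_l=x_{4l}+\mathbf{i}x_{4l+1}+\mathbf{j}x_{4l+2}+\mathbf{k}x_{4l+3}$, $0\le l\le n-1$, with the Euclidean norm $\|q\|$ and Lebesgue measure $dV$. An upper semicontinuous function $u:\mathbb{H}^n\to[-\infty,\infty)$ is plurisubharmonic (PSH) if it is subharmonic on each right quaternionic line $\{a+bt: t\in\mathbb{H}\}$, $a,b\in\mathbb{H}^n$, $b\neq0$; that is, on each such line its value at the center of a $3$-sphere is at most its average over that sphere. Put $$\begin{pmatrix}\nabla_{(2l)0}&\nabla_{(2l)1}\\ \nabla_{(2l+1)0}&\nabla_{(2l+1)1}\end{pmatrix}=\begin{pmatrix}\partial_{x_{4l}}+\mathbf{i}\partial_{x_{4l+1}}&-\partial_{x_{4l+2}}-\mathbf{i}\partial_{x_{4l+3}}\\ \partial_{x_{4l+2}}-\mathbf{i}\partial_{x_{4l+3}}&\partial_{x_{4l}}-\mathbf{i}\partial_{x_{4l+1}}\end{pmatrix},$$ let $\omega^0,\ldots,\omega^{2n-1}$ be a basis of $\mathbb{C}^{2n}$,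 and for a form $F=\sum_I f_I\,\omega^I$ with values in $\wedge^{\bullet}\mathbb{C}^{2n}$ let $d_\alpha F=\sum_{k,I}\nabla_{k\alpha}f_I\,\omega^k\wedge\omega^I$ ($\alpha=0,1$) and $\triangle F=d_0d_1F$. A current of order zero is $T=\sum_I T_I\,\omega^I$ with complex Radon measures $T_I$ on $\mathbb{H}^n$; it acts on smooth compactly supported forms $\eta$ of complementary degree by integrating the coefficient of $\omega^0\wedge\cdots\wedge\omega^{2n-1}$ in $T\wedge\eta$. If $u$ is locally integrable with respect to all the $T_I$, put $uT=\sum_I (uT_I)\,\omega^I$ and $\triangle u\wedge T:=\triangle(uT)$, i.e. $(\triangle u\wedge T)(\eta):=(uT)(\triangle\eta)$. Set $(\triangle u)^0=1$ and inductively $(\triangle u)^{k+1}=\triangle u\wedge(\triangle u)^k$, whenever $u$ is locally integrable with respect to the coefficients of $(\triangle u)^k$ and the result is again a current of order zero. A Radon measure $\mu$ is the Monge–Ampère measure of $u$ if $(\triangle u)^n$ is defined in this way and $(\triangle u)^n=\mu\;\omega^0\wedge\cdots\wedge\omega^{2n-1}$; one then writes $(\triangle u)^n=\mu$. Proposition.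 The function $q\mapsto-\dfrac{1}{\|q\|^2}$, with value $-\infty$ at $q=0$, is PSH on $\mathbb{H}^n$. Its Monge–Ampère measure is defined, unique, and equal to $$\left(\triangle\Big(-\frac{1}{\|q\|^2}\Big)\right)^n=\frac{8^n\,n!\,\pi^{2n}}{(2n)!}\,\delta_0,$$ where $\delta_0$ is the unit point mass at the origin. -/

import Mathlib

open scoped Quaternion

noncomputable section

namespace QuaternionicMA

open MeasureTheory

/-! ### Quaternionic space and plurisubharmonic functions -/

/-- `ℍⁿ`, identified with `ℝ⁴ⁿ` (Euclidean norm, Lebesgue measure): the real coordinates of the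
`l`-th quaternionic coordinate are
`q_l = x (l, 0) + i x (l, 1) + j x (l, 2) + k x (l, 3)`. -/
abbrev QSpace (n : ℕ) : Type := EuclideanSpace ℝ (Fin n × Fin 4)

/-- The point of `ℍⁿ` with the given quaternionic coordinates. -/
def ofQuat {n : ℕ} (q : Fin n → ℍ[ℝ]) : QSpace n :=
  WithLp.toLp 2 fun p => Quaternion.linearIsometryEquivTuple (q p.1) p.2

/-- The uniform probability measure on the unit sphere of `ℝ⁴ ≅ ℍ`. -/
def sphereMeasure : Measure (Metric.sphere (0 : EuclideanSpace ℝ (Fin 4)) 1) :=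
  ((volume : Measure (EuclideanSpace ℝ (Fin 4))).toSphere Set.univ)⁻¹ •
    (volume : Measure (EuclideanSpace ℝ (Fin 4))).toSphere

/-- The average of `v` over the sphere of centre `c` and radius `r` in `ℍ`, as the integral of the
positive part minus the integral of the negative part. (For an upper semicontinuous `v < +∞` the
former is finite, so that the difference is meaningful; it may be `-∞`.) -/
def sphereMean (v : ℍ[ℝ] → EReal) (c : ℍ[ℝ]) (r : ℝ) : EReal :=
  ((∫⁻ ω, (v (c + r • Quaternion.linearIsometryEquivTuple.symm ω.1)).toENNReal
      ∂sphereMeasure : ENNReal) : EReal) -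
  ((∫⁻ ω, (-v (c + r • Quaternion.linearIsometryEquivTuple.symm ω.1)).toENNReal
      ∂sphereMeasure : ENNReal) : EReal)

/-- Subharmonic functions `ℍ → [-∞, ∞)`, where `ℍ ≅ ℝ⁴`. -/
def IsSubharmonic (v : ℍ[ℝ] → EReal) : Prop :=
  UpperSemicontinuous v ∧ (∀ c, v c ≠ ⊤) ∧ ∀ (c : ℍ[ℝ]) (r : ℝ), 0 < r → v c ≤ sphereMean v c r

/-- `u : ℍⁿ → [-∞, ∞)` is plurisubharmonic: it is upper semicontinuous, and subharmonic on each
right quaternionic line `{a + b t : t ∈ ℍ}`, `b ≠ 0`. -/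
def IsPSH {n : ℕ} (u : QSpace n → EReal) : Prop :=
  UpperSemicontinuous u ∧ (∀ q, u q ≠ ⊤) ∧
    ∀ a b : Fin n → ℍ[ℝ], b ≠ 0 → IsSubharmonic fun t => u (ofQuat fun l => a l + b l * t)

/-! ### Forms and the operators `d₀`, `d₁`, `△` -/

/-- The real partial derivative `∂ / ∂x (l, a)` of a complex valued function. -/
def pderiv {n : ℕ} (l : Fin n) (a : Fin 4) (f : QSpace n → ℂ) (q : QSpace n) : ℂ :=
  fderiv ℝ f q (EuclideanSpace.single (l, a) 1)

/-- The operators `∇_{jα}`, `0 ≤ j < 2n`, `α = 0, 1`. Here `j = 2l + s` with `l = j.divNat` and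
`s = j.modNat`, and for fixed `l` the matrix `(∇_{(2l+s)α})` has rows `s = 0, 1` and columns
`α = 0, 1`. -/
def nabla {n : ℕ} (j : Fin (n * 2)) (α : Fin 2) (f : QSpace n → ℂ) (q : QSpace n) : ℂ :=
  let D : Fin 4 → ℂ := fun a => pderiv j.divNat a f q
  !![D 0 + Complex.I * D 1, -D 2 - Complex.I * D 3;
     D 2 - Complex.I * D 3, D 0 - Complex.I * D 1] j.modNat α

/-- Functions on `ℍⁿ` with values in the exterior algebra of `ℂ²ⁿ`, given by their coefficients:
`F` stands for `∑_I F I ω^I`, where `I` runs over the subsets of `{0, …, 2n-1}` and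
`ω^I = ω^{i₁} ∧ … ∧ ω^{i_p}` if `I = {i₁ < … < i_p}`. -/
abbrev Form (n : ℕ) : Type := Finset (Fin (n * 2)) → QSpace n → ℂ

/-- `d_α F = ∑_{k, I} ∇_{kα} F_I ω^k ∧ ω^I`. The coefficient at `ω^K` collects the pairs with
`K = {k} ∪ I`, `k ∉ I`, for which `ω^k ∧ ω^I = (-1)^{#{i ∈ I : i < k}} ω^K`. -/
def d {n : ℕ} (α : Fin 2) (F : Form n) : Form n := fun K q =>
  ∑ k ∈ K, (-1 : ℂ) ^ (K.filter (· < k)).card * nabla k α (F (K.erase k)) q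

/-- The Baston operator `△ = d₀ d₁`. -/
def baston {n : ℕ} (F : Form n) : Form n := d 0 (d 1 F)

/-- Test forms: all coefficients are smooth with compact support. -/
def IsTestForm {n : ℕ} (η : Form n) : Prop :=
  ∀ I, ContDiff ℝ ((⊤ : ℕ∞) : WithTop ℕ∞) (η I) ∧ HasCompactSupport (η I)

/-! ### Currents of order zero and the Monge-Ampère measure -/

/-- The sign `ε_I` with `ε_I ω^I ∧ ω^{Iᶜ} = ω^0 ∧ ω^1 ∧ … ∧ ω^{2n-1}`. -/
def wedgeSign {n : ℕ} (I : Finset (Fin (n * 2))) : ℂ :=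
  (-1 : ℂ) ^ ((I ×ˢ Iᶜ).filter fun p => p.2 < p.1).card

/-- A current of order zero, `T = ∑_I T_I ω^I`, whose coefficients are the complex Radon measures
`T_I = coeff I • base`, with `base` a (positive) Radon measure and `coeff I` locally
integrable. -/
structure RadonCurrent (n : ℕ) where
  base : Measure (QSpace n)
  coeff : Form n
  locallyFinite : IsLocallyFiniteMeasure base
  locallyIntegrable : ∀ I, LocallyIntegrable (coeff I) base

/-- The value `∑_I ε_I ∫ η_{Iᶜ} c_I dm` at the form `η` of the current `∑_I (c_I m) ω^I`. -/
def pairing {n : ℕ} (m : Measure (QSpace n)) (c : Form n) (η : Form n) : ℂ :=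
  ∑ I, wedgeSign I * ∫ q, c I q * η Iᶜ q ∂m

/-- The value `T(η)` of the current `T` at the test form `η`. -/
def RadonCurrent.apply {n : ℕ} (T : RadonCurrent n) (η : Form n) : ℂ :=
  pairing T.base T.coeff η

/-- The function `u` is locally integrable with respect to all the coefficients of `T`; in
particular these do not charge the set where `u` is infinite. So the current
`u T = ∑_I (u T_I) ω^I` is defined and has order zero. This holds for every `T` if `u` is
a locally bounded Borel function. -/
def RadonCurrent.Integrates {n : ℕ} (T : RadonCurrent n) (u : QSpace n → EReal) : Prop :=
  ∀ I, (∀ᵐ q ∂T.base, u q = ⊥ ∨ u q = ⊤ → T.coeff I q = 0) ∧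
    LocallyIntegrable (fun q => ((u q).toReal : ℂ) * T.coeff I q) T.base

/-- The value `(u T)(η)` of the current `u T` at the test form `η`. -/
def RadonCurrent.mulApply {n : ℕ} (u : QSpace n → EReal) (T : RadonCurrent n) (η : Form n) : ℂ :=
  pairing T.base (fun I q => ((u q).toReal : ℂ) * T.coeff I q) η

/-- `S = △u ∧ T`, where `△u ∧ T := △(uT)`, that is, `(△u ∧ T)(η) = (uT)(△η)` for all test
forms `η`; it is part of the assertion that `uT` is defined. -/
def IsBastonWedge {n : ℕ} (u : QSpace n → EReal) (T S : RadonCurrent n) : Prop :=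
  T.Integrates u ∧ ∀ η : Form n, IsTestForm η → S.apply η = T.mulApply u (baston η)

/-- `T = (△u)^k`: inductively `(△u)^0 = 1` and `(△u)^{k+1} = △u ∧ (△u)^k = △(u (△u)^k)`. -/
def IsBastonPower {n : ℕ} (u : QSpace n → EReal) : ℕ → RadonCurrent n → Prop
  | 0, T => ∀ η : Form n, IsTestForm η → T.apply η = ∫ q, η Finset.univ q
  | k + 1, S => ∃ T : RadonCurrent n, IsBastonPower u k T ∧ IsBastonWedge u T S

/-- `μ` is the Monge-Ampère measure of `u`: the Radon measure with
`(△u)^n = μ ω^0 ∧ ω^1 ∧ … ∧ ω^{2n-1}`. -/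
def IsMongeAmpereMeasure {n : ℕ} (u : QSpace n → EReal) (μ : Measure (QSpace n)) : Prop :=
  IsLocallyFiniteMeasure μ ∧ ∃ T : RadonCurrent n, IsBastonPower u n T ∧
    ∀ η : Form n, IsTestForm η → T.apply η = ∫ q, η ∅ q ∂μ

/-- The function `-1 / ‖q‖²` on `ℍⁿ`, with the value `-∞` at the origin. -/
def negInvNormSq (n : ℕ) (q : QSpace n) : EReal :=
  if q = 0 then ⊥ else ((-1 / ‖q‖ ^ 2 : ℝ) : EReal)

end QuaternionicMA

end

open scoped Quaternion

noncomputable section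

namespace QuaternionicMA

open MeasureTheory Filter Topology

/-!
Regularise `-1 / ‖q‖²` to `u_ε = -1 / (‖q‖² + ε)`. The forms `(△u_ε)^k` are explicit: their
coefficients are powers of `(‖q‖² + ε)⁻¹` times polynomials in `q`, and for `k < n` they are
dominated by `‖q‖^(-4k)` uniformly in `ε`, so that they converge to locally integrable densities of
the powers of `△u`. For `k = n` the density is a multiple of `ε / (‖q‖² + ε)^(2n + 1)`, an
approximate identity by scaling, which produces the point mass. Uniqueness holds because a current
of order zero is determined by its values on test forms.

For plurisubharmonicity, let `T` be a similarity of ratio `ρ` on `ℝ⁴` and `A = ‖p‖² + ρ²`. Expanding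
in a geometric series, the mean of `‖p + T ω‖⁻²` over the unit sphere is `A⁻¹ C(x)` for some
`x ≤ ‖p‖² ρ² / A²`, where `C` is the generating function of the Catalan numbers, the least solution
of `C = 1 + x C²`. As `y = A / ‖p‖²` satisfies `1 + x y² ≤ y`, the mean is at most `y / A = ‖p‖⁻²`.
-/

/-! ### The exterior algebra in coordinates -/

section Exterior

variable {ι R : Type*} [CommRing R]

/-- The parity involution `∑_I v_I ω^I ↦ ∑_I (-1)^|I| v_I ω^I` of the exterior algebra. -/
def parity : Module.End R (Finset ι → R) :=
  LinearMap.pi fun I => (-1 : R) ^ I.card • LinearMap.proj I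

lemma parity_apply (v : Finset ι → R) (I : Finset ι) : parity v I = (-1) ^ I.card * v I := rfl

variable [LinearOrder ι]

/-- Left multiplication by the basis vector `ω^j` on the exterior algebra of `R^ι`, whose element
`∑_I v_I ω^I` is encoded as the function `v` on the finite subsets of `ι`. -/
def wedgeLeft (j : ι) : Module.End R (Finset ι → R) where
  toFun v K := if j ∈ K then (-1) ^ (K.filter (· < j)).card * v (K.erase j) else 0
  map_add' v w := by
    ext K
    by_cases h : j ∈ K <;> simp [h, mul_add]
  map_smul' c v := by
    ext K
    by_cases h : j ∈ K <;> simp [h, mul_left_comm]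

lemma wedgeLeft_apply (j : ι) (v : Finset ι → R) (K : Finset ι) :
    wedgeLeft j v K = if j ∈ K then (-1) ^ (K.filter (· < j)).card * v (K.erase j) else 0 := rfl

lemma wedgeLeft_wedgeLeft_self (j : ι) (v : Finset ι → R) : wedgeLeft j (wedgeLeft j v) = 0 := by
  ext K
  simp [wedgeLeft_apply]

lemma filter_lt_erase_of_le {j k : ι} (h : k ≤ j) (K : Finset ι) :
    (K.erase j).filter (· < k) = K.filter (· < k) := by
  rw [Finset.filter_erase, Finset.erase_eq_of_notMem (by simp [h])]

lemma wedgeLeft_wedgeLeft_of_lt {j k : ι} (h : j < k) (v : Finset ι → R) :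
    wedgeLeft j (wedgeLeft k v) = -wedgeLeft k (wedgeLeft j v) := by
  ext K
  simp only [Pi.neg_apply, wedgeLeft_apply, Finset.mem_erase]
  by_cases hj : j ∈ K <;> by_cases hk : k ∈ K <;> simp only [hj, hk, h.ne, h.ne', and_true,
    and_false, ne_eq, not_false_eq_true, if_true, if_false, mul_zero, neg_zero]
  have hsign : (K.filter (· < k)).card = ((K.erase j).filter (· < k)).card + 1 := by
    rw [Finset.filter_erase, Finset.card_erase_add_one (Finset.mem_filter.2 ⟨hj, h⟩)]
  rw [filter_lt_erase_of_le h.le, hsign, Finset.erase_right_comm]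
  ring

lemma wedgeLeft_anticomm (j k : ι) (v : Finset ι → R) :
    wedgeLeft j (wedgeLeft k v) = -wedgeLeft k (wedgeLeft j v) := by
  rcases lt_trichotomy j k with h | rfl | h
  · exact wedgeLeft_wedgeLeft_of_lt h v
  · simp [wedgeLeft_wedgeLeft_self]
  · rw [wedgeLeft_wedgeLeft_of_lt h, neg_neg]

lemma commute_wedgeLeft_mul_wedgeLeft (i j k : ι) :
    Commute (wedgeLeft (R := R) i * wedgeLeft j) (wedgeLeft k) := by
  refine LinearMap.ext fun v => ?_
  simp only [Module.End.mul_apply]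
  rw [wedgeLeft_anticomm j k, map_neg, wedgeLeft_anticomm i k, neg_neg]

lemma wedgeLeft_single {j : ι} {S : Finset ι} (hj : j ∉ S) :
    wedgeLeft j (Pi.single S 1) =
      (-1 : R) ^ (S.filter (· < j)).card • (Pi.single (insert j S) 1 : Finset ι → R) := by
  ext K
  rw [wedgeLeft_apply, Pi.smul_apply, smul_eq_mul, Pi.single_apply, Pi.single_apply]
  by_cases hK : K = insert j S
  · subst hK
    simp [hj, Finset.filter_insert]
  · have : j ∈ K → K.erase j ≠ S := by
      rintro h rfl; exact hK (Finset.insert_erase h).symm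
    by_cases h : j ∈ K <;> simp [h, hK, this]

lemma wedgeLeft_wedgeLeft_single_of_covBy {j k : ι} (hjk : j ⋖ k) {S : Finset ι} (hj : j ∉ S)
    (hk : k ∉ S) :
    wedgeLeft j (wedgeLeft k (Pi.single S 1)) =
      (Pi.single (insert j (insert k S)) 1 : Finset ι → R) := by
  have hfilter : (insert k S).filter (· < j) = S.filter (· < k) := by
    rw [Finset.filter_insert, if_neg hjk.lt.not_gt]
    refine Finset.filter_congr fun i hi => ⟨fun h => h.trans hjk.lt, fun h => ?_⟩
    exact lt_of_le_of_ne (hjk.le_of_lt h) (ne_of_mem_of_not_mem hi hj)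
  have hj' : j ∉ insert k S := by simp [hj, hjk.lt.ne]
  rw [wedgeLeft_single hk, map_smul, wedgeLeft_single hj', hfilter, smul_smul, ← mul_pow]
  simp

lemma parity_wedgeLeft (j : ι) (v : Finset ι → R) :
    parity (wedgeLeft j v) = -wedgeLeft j (parity v) := by
  ext K
  simp only [Pi.neg_apply, wedgeLeft_apply, parity_apply]
  split_ifs with h
  · rw [← Finset.card_erase_add_one h]
    ring
  · simp

end Exterior

section SquareZero

variable {A : Type*} [Ring A]

lemma add_pow_succ_of_mul_self_eq_zero {x y : A} (h : Commute x y) (hx : x * x = 0) (m : ℕ) :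
    (x + y) ^ (m + 1) = y ^ (m + 1) + (m + 1) • (x * y ^ m) := by
  have hx' (k : ℕ) : x ^ (k + 1 + 1) = 0 := by rw [pow_succ, pow_succ, mul_assoc, hx, mul_zero]
  rw [h.add_pow, Finset.sum_range_succ', Finset.sum_range_succ', Finset.sum_eq_zero]
  · simp only [zero_add, pow_one, pow_zero, one_mul, Nat.add_sub_cancel, Nat.sub_zero,
      Nat.choose_one_right, Nat.choose_zero_right, Nat.cast_one, mul_one, nsmul_eq_mul,
      Nat.cast_comm, add_comm (y ^ _)]
  · intro k _
    simp [hx']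

lemma sum_pow_eq_zero_of_card_lt {ι : Type*} {x : ι → A} (hx : ∀ i, x i * x i = 0)
    (hc : ∀ i j, Commute (x i) (x j)) (s : Finset ι) {m : ℕ} (hm : s.card < m) :
    (∑ i ∈ s, x i) ^ m = 0 := by
  classical
  induction s using Finset.induction_on generalizing m with
  | empty => simp [(Nat.zero_lt_of_lt hm).ne']
  | insert a s ha ih =>
    rw [Finset.card_insert_of_notMem ha] at hm
    obtain ⟨m, rfl⟩ := Nat.exists_eq_add_one_of_ne_zero (Nat.ne_zero_of_lt hm)
    rw [Finset.sum_insert ha, add_pow_succ_of_mul_self_eq_zero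
      (Commute.sum_right _ _ _ fun i _ => hc a i) (hx a), ih (by omega), ih (by omega)]
    simp

lemma mul_sum_pow_eq_mul_sum_erase_pow {ι : Type*} [DecidableEq ι] {x : ι → A}
    (hx : ∀ i, x i * x i = 0) (hc : ∀ i j, Commute (x i) (x j)) {a : A} {i : ι}
    (ha : a * x i = 0) (s : Finset ι) (m : ℕ) :
    a * (∑ j ∈ s, x j) ^ m = a * (∑ j ∈ s.erase i, x j) ^ m := by
  rcases m with _ | m
  · simp
  by_cases hi : i ∈ s
  · rw [← Finset.add_sum_erase s x hi, add_pow_succ_of_mul_self_eq_zero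
      (Commute.sum_right _ _ _ fun j _ => hc i j) (hx i), mul_add, mul_smul_comm, ← mul_assoc, ha]
    simp
  · rw [Finset.erase_eq_of_notMem hi]

end SquareZero

/-! ### The two-form `β = ∑ ω^{2l} ∧ ω^{2l+1}` -/

section Beta

variable {n : ℕ}

/-- The exterior algebra of `ℂ²ⁿ` in coordinates: the values of a `Form n`. -/
abbrev Coeffs (n : ℕ) : Type := Finset (Fin (n * 2)) → ℂ

/-- The index `2l + s`. -/
abbrev idx (l : Fin n) (s : Fin 2) : Fin (n * 2) := finProdFinEquiv (l, s)

lemma divNat_idx (l : Fin n) (s : Fin 2) : (idx l s).divNat = l :=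
  congrArg Prod.fst (finProdFinEquiv.symm_apply_apply (l, s))

lemma modNat_idx (l : Fin n) (s : Fin 2) : (idx l s).modNat = s :=
  congrArg Prod.snd (finProdFinEquiv.symm_apply_apply (l, s))

lemma idx_divNat_modNat (j : Fin (n * 2)) : idx j.divNat j.modNat = j :=
  finProdFinEquiv.apply_symm_apply j

lemma sum_idx {M : Type*} [AddCommMonoid M] (f : Fin (n * 2) → M) :
    ∑ j, f j = ∑ l : Fin n, ∑ s : Fin 2, f (idx l s) := by
  rw [← finProdFinEquiv.sum_comp, Fintype.sum_prod_type]

lemma idx_zero_covBy_idx_one (l : Fin n) : idx l 0 ⋖ idx l 1 := by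
  rw [Fin.covBy_iff, Nat.covBy_iff_add_one_eq]
  simp [add_comm]

/-- Multiplication by `ω^{2l} ∧ ω^{2l+1}`. -/
def wedgePair (l : Fin n) : Module.End ℂ (Coeffs n) := wedgeLeft (idx l 0) * wedgeLeft (idx l 1)

/-- Multiplication by `β = ∑_l ω^{2l} ∧ ω^{2l+1}`, with `l` restricted to `s`. -/
def wedgeBeta (s : Finset (Fin n)) : Module.End ℂ (Coeffs n) := ∑ l ∈ s, wedgePair l

/-- The unit of the exterior algebra. -/
abbrev vac (n : ℕ) : Coeffs n := Pi.single ∅ 1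

/-- The vector `ω^0 ∧ … ∧ ω^{2n-1}`. -/
abbrev vol (n : ℕ) : Coeffs n := Pi.single Finset.univ 1

lemma commute_wedgePair (l m : Fin n) : Commute (wedgePair l) (wedgePair m) :=
  (commute_wedgeLeft_mul_wedgeLeft _ _ _).mul_right (commute_wedgeLeft_mul_wedgeLeft _ _ _)

lemma wedgeLeft_mul_wedgePair (l : Fin n) (s : Fin 2) :
    wedgeLeft (idx l s) * wedgePair l = 0 := by
  refine LinearMap.ext fun v => ?_
  change wedgeLeft (idx l s) (wedgeLeft (idx l 0) (wedgeLeft (idx l 1) v)) = 0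
  fin_cases s
  · exact wedgeLeft_wedgeLeft_self _ _
  · change wedgeLeft (idx l 1) (wedgeLeft (idx l 0) (wedgeLeft (idx l 1) v)) = 0
    rw [wedgeLeft_anticomm (idx l 0), map_neg, wedgeLeft_wedgeLeft_self, neg_zero]

lemma wedgePair_mul_self (l : Fin n) : wedgePair l * wedgePair l = 0 := by
  conv_lhs => lhs; rw [wedgePair]
  rw [mul_assoc, wedgeLeft_mul_wedgePair, mul_zero]

lemma wedgeBeta_pow_eq_zero (s : Finset (Fin n)) {m : ℕ} (hm : s.card < m) :
    wedgeBeta s ^ m = 0 :=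
  sum_pow_eq_zero_of_card_lt wedgePair_mul_self commute_wedgePair s hm

lemma wedgeLeft_mul_wedgeBeta_pow (l : Fin n) (t : Fin 2) (s : Finset (Fin n)) (m : ℕ) :
    wedgeLeft (idx l t) * wedgeBeta s ^ m = wedgeLeft (idx l t) * wedgeBeta (s.erase l) ^ m :=
  mul_sum_pow_eq_mul_sum_erase_pow wedgePair_mul_self commute_wedgePair
    (wedgeLeft_mul_wedgePair l t) s m

/-- The indices `2l` and `2l + 1` with `l ∈ s`. -/
def pairs (s : Finset (Fin n)) : Finset (Fin (n * 2)) := Finset.univ.filter (·.divNat ∈ s)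

lemma idx_mem_pairs {l : Fin n} {t : Fin 2} {s : Finset (Fin n)} : idx l t ∈ pairs s ↔ l ∈ s := by
  rw [pairs, Finset.mem_filter_univ, divNat_idx]

lemma pairs_insert (a : Fin n) (s : Finset (Fin n)) :
    pairs (insert a s) = insert (idx a 0) (insert (idx a 1) (pairs s)) := by
  ext j
  obtain ⟨l, t, rfl⟩ : ∃ l t, idx l t = j := ⟨_, _, idx_divNat_modNat j⟩
  simp only [Finset.mem_insert, idx_mem_pairs, EmbeddingLike.apply_eq_iff_eq, Prod.mk.injEq]
  fin_cases t <;> simp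

lemma wedgePair_single {a : Fin n} {s : Finset (Fin n)} (ha : a ∉ s) :
    wedgePair a (Pi.single (pairs s) 1) = Pi.single (pairs (insert a s)) 1 := by
  rw [pairs_insert]
  exact wedgeLeft_wedgeLeft_single_of_covBy (idx_zero_covBy_idx_one a) (by rwa [idx_mem_pairs])
    (by rwa [idx_mem_pairs])

lemma wedgeBeta_pow_card (s : Finset (Fin n)) :
    (wedgeBeta s ^ s.card) (vac n) = (s.card.factorial : ℂ) • Pi.single (pairs s) 1 := by
  induction s using Finset.induction_on with
  | empty => simp [pairs]
  | insert a s ha ih =>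
    have hpow : wedgeBeta (insert a s) ^ (s.card + 1) =
        (s.card + 1) • (wedgePair a * wedgeBeta s ^ s.card) := by
      rw [wedgeBeta, Finset.sum_insert ha, add_pow_succ_of_mul_self_eq_zero
        (Commute.sum_right _ _ _ fun l _ => commute_wedgePair a l) (wedgePair_mul_self a),
        ← wedgeBeta, wedgeBeta_pow_eq_zero s (Nat.lt_succ_self _), zero_add]
    rw [Finset.card_insert_of_notMem ha, hpow, LinearMap.smul_apply, Module.End.mul_apply, ih,
      map_smul, wedgePair_single ha, ← Nat.cast_smul_eq_nsmul ℂ, smul_smul, Nat.factorial_succ,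
      Nat.cast_mul]

lemma pairs_univ (n : ℕ) : pairs (Finset.univ : Finset (Fin n)) = Finset.univ := by
  simp [pairs]

lemma wedgeBeta_univ_pow (n : ℕ) :
    (wedgeBeta Finset.univ ^ n) (vac n) = (n.factorial : ℂ) • vol n := by
  simpa [pairs_univ] using wedgeBeta_pow_card (Finset.univ : Finset (Fin n))

lemma wedgePair_wedgeBeta_univ_pow (l : Fin n) :
    wedgePair l ((wedgeBeta Finset.univ ^ (n - 1)) (vac n)) =
      ((n - 1).factorial : ℂ) • vol n := by
  have hcard : (Finset.univ.erase l).card = n - 1 := by simp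
  have hpow := wedgeBeta_pow_card (Finset.univ.erase l)
  rw [hcard] at hpow
  rw [← Module.End.mul_apply, wedgePair, mul_assoc, wedgeLeft_mul_wedgeBeta_pow, ← mul_assoc,
    ← wedgePair, Module.End.mul_apply, hpow, map_smul, wedgePair_single (Finset.notMem_erase _ _),
    Finset.insert_erase (Finset.mem_univ l), pairs_univ]

lemma wedgeLeft_wedgeLeft_wedgeBeta_univ_pow {l m : Fin n} (h : l ≠ m) (s t : Fin 2)
    (v : Coeffs n) :
    wedgeLeft (idx l s) (wedgeLeft (idx m t) ((wedgeBeta Finset.univ ^ (n - 1)) v)) = 0 := by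
  have hcard : ((Finset.univ.erase m).erase l).card < n - 1 := by
    have := Fin.val_ne_of_ne h
    rw [Finset.card_erase_of_mem (by simp [h]), Finset.card_erase_of_mem (Finset.mem_univ _),
      Finset.card_univ, Fintype.card_fin]
    omega
  have hzero : wedgeLeft (idx l s) ((wedgeBeta (Finset.univ.erase m) ^ (n - 1)) v) = 0 := by
    rw [← Module.End.mul_apply, wedgeLeft_mul_wedgeBeta_pow l, wedgeBeta_pow_eq_zero _ hcard,
      mul_zero, LinearMap.zero_apply]
  rw [← Module.End.mul_apply (wedgeLeft (idx m t)), wedgeLeft_mul_wedgeBeta_pow m,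
    Module.End.mul_apply, wedgeLeft_anticomm, hzero, map_zero, neg_zero]

lemma parity_vac (n : ℕ) : parity (vac n) = vac n := by
  ext I
  by_cases h : I = ∅ <;> simp [parity_apply, h]

lemma commute_parity_wedgeBeta (s : Finset (Fin n)) : Commute parity (wedgeBeta s) := by
  refine Commute.sum_right _ _ _ fun l _ => ?_
  refine LinearMap.ext fun v => ?_
  simp only [wedgePair, Module.End.mul_apply, parity_wedgeLeft, map_neg, neg_neg]

lemma parity_wedgeBeta_pow_vac (s : Finset (Fin n)) (k : ℕ) :
    parity ((wedgeBeta s ^ k) (vac n)) = (wedgeBeta s ^ k) (vac n) := by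
  rw [← Module.End.mul_apply, ((commute_parity_wedgeBeta s).pow_right k).eq, Module.End.mul_apply,
    parity_vac]

end Beta

/-! ### The principal symbols of `d₀` and `d₁` -/

section Symbol

variable {n : ℕ}

/-- The coefficients of the operators `∇_{jα}`: for `j = 2l + s` one has
`∇_{jα} = ∑_a nablaCoeff s α a • ∂ / ∂x (l, a)`. -/
def nablaCoeff (s α : Fin 2) : Fin 4 → ℂ :=
  ![![![1, Complex.I, 0, 0], ![0, 0, -1, -Complex.I]],
    ![![0, 0, 1, -Complex.I], ![1, -Complex.I, 0, 0]]] s α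

lemma nabla_eq_sum (j : Fin (n * 2)) (α : Fin 2) (f : QSpace n → ℂ) (q : QSpace n) :
    nabla j α f q = ∑ a, nablaCoeff j.modNat α a * pderiv j.divNat a f q := by
  unfold nabla nablaCoeff
  generalize j.modNat = s
  fin_cases s <;> fin_cases α <;> simp [Fin.sum_univ_four] <;> ring

/-- The value of the principal symbol of `d_α` at the `p`-th coordinate direction: `d_α` is
the sum of `coordSymbol α p ∘ ∂ / ∂x p` over all `p`. -/
def coordSymbol (α : Fin 2) (p : Fin n × Fin 4) : Module.End ℂ (Coeffs n) :=
  ∑ s, nablaCoeff s α p.2 • wedgeLeft (idx p.1 s)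

lemma coordSymbol_apply (α : Fin 2) (p : Fin n × Fin 4) (v : Coeffs n) :
    coordSymbol α p v = ∑ s, nablaCoeff s α p.2 • wedgeLeft (idx p.1 s) v := by
  simp [coordSymbol]

lemma coordSymbol_anticomm (α β : Fin 2) (p r : Fin n × Fin 4) (v : Coeffs n) :
    coordSymbol α p (coordSymbol β r v) = -coordSymbol β r (coordSymbol α p v) := by
  simp only [coordSymbol_apply, map_sum, map_smul, Finset.smul_sum, ← Finset.sum_neg_distrib]
  rw [Finset.sum_comm]
  refine Finset.sum_congr rfl fun s _ => Finset.sum_congr rfl fun t _ => ?_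
  rw [wedgeLeft_anticomm, smul_neg, smul_neg, smul_comm]

lemma parity_coordSymbol (α : Fin 2) (p : Fin n × Fin 4) (v : Coeffs n) :
    parity (coordSymbol α p v) = -coordSymbol α p (parity v) := by
  simp only [coordSymbol_apply, map_sum, map_smul, parity_wedgeLeft, smul_neg,
    Finset.sum_neg_distrib]

lemma sum_coordSymbol_self (α : Fin 2) (v : Coeffs n) :
    ∑ p, coordSymbol α p (coordSymbol α p v) = 0 := by
  refine Finset.sum_eq_zero fun p _ => self_eq_neg.1 ?_
  exact coordSymbol_anticomm α α p p v

lemma sum_coordSymbol_zero_one (v : Coeffs n) :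
    ∑ p, coordSymbol 0 p (coordSymbol 1 p v) = (4 : ℝ) • wedgeBeta Finset.univ v := by
  rw [wedgeBeta, LinearMap.sum_apply, Finset.smul_sum, Fintype.sum_prod_type]
  refine Finset.sum_congr rfl fun l _ => ?_
  have hanti := wedgeLeft_anticomm (idx l 1) (idx l 0) v
  simp only [coordSymbol_apply, nablaCoeff, Fin.sum_univ_four, Fin.sum_univ_two]
  simp only [Fin.isValue, Matrix.cons_val', Matrix.cons_val_zero, Matrix.cons_val_fin_one,
    Matrix.cons_val_one, Matrix.cons_val, zero_smul, one_smul, zero_add, add_zero, smul_zero,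
    neg_zero, neg_neg, neg_smul, neg_mul, smul_neg, smul_smul, map_neg, map_smul, Complex.I_mul_I,
    wedgePair, Module.End.mul_apply, wedgeLeft_wedgeLeft_self, hanti]
  module

lemma sum_coordSymbol_one_zero (v : Coeffs n) :
    ∑ p, coordSymbol 1 p (coordSymbol 0 p v) = -(4 : ℝ) • wedgeBeta Finset.univ v := by
  rw [neg_smul, ← sum_coordSymbol_zero_one, ← Finset.sum_neg_distrib]
  exact Finset.sum_congr rfl fun p _ => coordSymbol_anticomm 1 0 p p v

/-- The principal symbol of `d_α`: exterior multiplication by the form with coefficients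
`∇_{jα} ‖q‖² / 2`. -/
def symbol (α : Fin 2) : QSpace n →L[ℝ] Coeffs n →L[ℝ] Coeffs n :=
  (LinearMap.mk₂ ℝ (fun q v => ∑ p, q p • coordSymbol α p v)
    (fun _ _ _ => by simp [add_smul, Finset.sum_add_distrib])
    (fun _ _ _ => by simp [mul_smul, Finset.smul_sum])
    (fun _ _ _ => by simp [Finset.sum_add_distrib])
    (fun c q v => by
      simp only [LinearMap.map_smul_of_tower, Finset.smul_sum]
      exact Finset.sum_congr rfl fun p _ => smul_comm _ _ _)).toContinuousBilinearMap

lemma symbol_apply (α : Fin 2) (q : QSpace n) (v : Coeffs n) :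
    symbol α q v = ∑ p, q p • coordSymbol α p v := rfl

lemma symbol_single (α : Fin 2) (p : Fin n × Fin 4) (v : Coeffs n) :
    symbol α (EuclideanSpace.single p 1) v = coordSymbol α p v := by
  simp [symbol_apply]

lemma coordSymbol_symbol (α β : Fin 2) (p : Fin n × Fin 4) (q : QSpace n) (v : Coeffs n) :
    coordSymbol α p (symbol β q v) = -symbol β q (coordSymbol α p v) := by
  simp only [symbol_apply, map_sum, LinearMap.map_smul_of_tower, coordSymbol_anticomm α β p,
    smul_neg, Finset.sum_neg_distrib]

lemma symbol_anticomm (α β : Fin 2) (q r : QSpace n) (v : Coeffs n) :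
    symbol α q (symbol β r v) = -symbol β r (symbol α q v) := by
  rw [symbol_apply α q (symbol β r v)]
  simp only [coordSymbol_symbol, symbol_apply α q v, map_sum, map_smul, smul_neg,
    Finset.sum_neg_distrib]

lemma symbol_symbol_self (α : Fin 2) (q : QSpace n) (v : Coeffs n) :
    symbol α q (symbol α q v) = 0 :=
  self_eq_neg.1 (symbol_anticomm α α q q v)

lemma parity_symbol (α : Fin 2) (q : QSpace n) (v : Coeffs n) :
    parity (symbol α q v) = -symbol α q (parity v) := by
  simp only [symbol_apply, map_sum, LinearMap.map_smul_of_tower, parity_coordSymbol, smul_neg,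
    Finset.sum_neg_distrib]

lemma symbol_symbol_wedgeBeta_univ_pow (q : QSpace n) :
    symbol 0 q (symbol 1 q ((wedgeBeta Finset.univ ^ (n - 1)) (vac n))) =
      ‖q‖ ^ 2 • ((n - 1).factorial : ℂ) • vol n := by
  set w := (wedgeBeta Finset.univ ^ (n - 1)) (vac n) with hw
  have hoff (l m : Fin n) (hlm : m ≠ l) (a b : Fin 4) :
      coordSymbol 0 (l, a) (coordSymbol 1 (m, b) w) = 0 := by
    simp [coordSymbol_apply, hw, wedgeLeft_wedgeLeft_wedgeBeta_univ_pow hlm.symm]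
  have hdiag (l : Fin n) : ∑ a, ∑ b, q (l, a) • q (l, b) •
      coordSymbol 0 (l, a) (coordSymbol 1 (l, b) w) = (∑ a, q (l, a) ^ 2) • wedgePair l w := by
    have hanti := wedgeLeft_anticomm (idx l 1) (idx l 0) w
    simp only [coordSymbol_apply, nablaCoeff, Fin.sum_univ_four, Fin.sum_univ_two]
    simp only [one_mul, zero_mul, Fin.isValue, Matrix.cons_val', Matrix.cons_val_zero,
      Matrix.cons_val_fin_one, Matrix.cons_val_one, Matrix.cons_val, zero_smul, one_smul, zero_add,
      add_zero, smul_zero, neg_zero, neg_neg, neg_smul, neg_mul, smul_neg, smul_smul, map_neg,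
      map_smul, Complex.I_mul_I, wedgePair, Module.End.mul_apply, wedgeLeft_wedgeLeft_self, hanti]
    module
  calc symbol 0 q (symbol 1 q w)
      = ∑ l, ∑ a, ∑ m, ∑ b, q (l, a) • q (m, b) •
          coordSymbol 0 (l, a) (coordSymbol 1 (m, b) w) := by
        rw [symbol_apply 0]
        simp only [symbol_apply 1, map_sum, LinearMap.map_smul_of_tower, Finset.smul_sum,
          Fintype.sum_prod_type]
    _ = ∑ l, ∑ a, ∑ b, q (l, a) • q (l, b) •
          coordSymbol 0 (l, a) (coordSymbol 1 (l, b) w) := by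
        refine Finset.sum_congr rfl fun l _ => Finset.sum_congr rfl fun a _ =>
          Fintype.sum_eq_single l fun m hml => Finset.sum_eq_zero fun b _ => ?_
        rw [hoff l m hml, smul_zero, smul_zero]
    _ = ‖q‖ ^ 2 • ((n - 1).factorial : ℂ) • vol n := by
        rw [Finset.sum_congr rfl fun l _ => hdiag l]
        simp only [hw, wedgePair_wedgeBeta_univ_pow, ← Finset.sum_smul,
          EuclideanSpace.norm_sq_eq, Real.norm_eq_abs, sq_abs, Fintype.sum_prod_type]

end Symbol

/-! ### `d_α` on vector-valued functions and integration by parts -/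

section VectorForms

variable {n : ℕ}

/-- The operator `d_α` on forms regarded as functions with values in the exterior algebra. -/
def dVec (α : Fin 2) (F : QSpace n → Coeffs n) (q : QSpace n) : Coeffs n :=
  ∑ p, symbol α (EuclideanSpace.single p 1) (fderiv ℝ F q (EuclideanSpace.single p 1))

lemma d_eq_dVec (α : Fin 2) {F : QSpace n → Coeffs n} (hF : Differentiable ℝ F) :
    d α (fun I q => F q I) = fun I q => dVec α F q I := by
  ext K q
  have hpderiv (l : Fin n) (a : Fin 4) (I : Finset (Fin (n * 2))) :
      pderiv l a (fun q => F q I) q = fderiv ℝ F q (EuclideanSpace.single (l, a) 1) I := by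
    rw [pderiv, fderiv_apply (hF q) I, ContinuousLinearMap.comp_apply,
      ContinuousLinearMap.proj_apply]
  calc d α (fun I q => F q I) K q
      = ∑ j, ∑ a, nablaCoeff j.modNat α a *
          wedgeLeft j (fderiv ℝ F q (EuclideanSpace.single (j.divNat, a) 1)) K := by
        simp only [d, nabla_eq_sum, hpderiv, wedgeLeft_apply, mul_ite, mul_zero, Finset.mul_sum,
          mul_left_comm, Finset.sum_ite_irrel, Finset.sum_const_zero, Finset.sum_ite_mem,
          Finset.univ_inter]
    _ = dVec α F q K := by
        simp only [dVec, symbol_single, coordSymbol_apply, Finset.sum_apply, Pi.smul_apply,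
          smul_eq_mul, sum_idx, divNat_idx, modNat_idx, Fintype.sum_prod_type]
        exact Finset.sum_congr rfl fun l _ => Finset.sum_comm

lemma dVec_const (α : Fin 2) (v : Coeffs n) (q : QSpace n) : dVec α (fun _ => v) q = 0 := by
  simp [dVec]

lemma dVec_sub (α : Fin 2) {F G : QSpace n → Coeffs n} {q : QSpace n}
    (hF : DifferentiableAt ℝ F q) (hG : DifferentiableAt ℝ G q) :
    dVec α (fun q => F q - G q) q = dVec α F q - dVec α G q := by
  simp [dVec, fderiv_fun_sub hF hG]

lemma dVec_const_smul (α : Fin 2) (c : ℝ) {F : QSpace n → Coeffs n} {q : QSpace n}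
    (hF : DifferentiableAt ℝ F q) : dVec α (fun q => c • F q) q = c • dVec α F q := by
  simp [dVec, fderiv_fun_const_smul hF, Finset.smul_sum]

lemma dVec_radial_smul (α : Fin 2) {φ : ℝ → ℝ} {φ' : ℝ} {F : QSpace n → Coeffs n} {q : QSpace n}
    (hφ : HasDerivAt φ φ' (‖q‖ ^ 2)) (hF : DifferentiableAt ℝ F q) :
    dVec α (fun q => φ (‖q‖ ^ 2) • F q) q =
      φ (‖q‖ ^ 2) • dVec α F q + (2 * φ') • symbol α q (F q) := by
  have h := (hφ.comp_hasFDerivAt q (hasStrictFDerivAt_norm_sq q).hasFDerivAt).fun_smul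
    hF.hasFDerivAt
  simp only [Function.comp_apply] at h
  have hsum : symbol α q (F q) =
      ∑ p, q p • symbol α (EuclideanSpace.single p 1) (F q) := by
    simp only [symbol_apply α q, symbol_single]
  rw [hsum, dVec, h.fderiv]
  simp [EuclideanSpace.inner_single_right, dVec, Finset.smul_sum, Finset.sum_add_distrib,
    smul_smul, mul_comm, mul_assoc]

lemma dVec_symbol (α β : Fin 2) {F : QSpace n → Coeffs n} {q : QSpace n}
    (hF : DifferentiableAt ℝ F q) :
    dVec α (fun q => symbol β q (F q)) q =
      ∑ p, coordSymbol α p (coordSymbol β p (F q)) - symbol β q (dVec α F q) := by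
  have h := (symbol β).hasFDerivAt_of_bilinear (hasFDerivAt_id q) hF.hasFDerivAt
  simp only [id] at h
  simp only [dVec, h.fderiv, add_apply, ContinuousLinearMap.precompR_apply,
    ContinuousLinearMap.compL_apply, ContinuousLinearMap.comp_apply,
    ContinuousLinearMap.precompL_apply, ContinuousLinearMap.id_apply, map_add, map_sum,
    symbol_anticomm α β _ q, symbol_single, neg_add_eq_sub, Finset.sum_sub_distrib]

lemma contDiff_dVec (α : Fin 2) {F : QSpace n → Coeffs n} {m k : WithTop ℕ∞}
    (hF : ContDiff ℝ m F) (hk : k + 1 ≤ m) : ContDiff ℝ k (dVec α F) :=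
  ContDiff.sum fun p _ => (symbol α (EuclideanSpace.single p 1)).contDiff.comp
    ((hF.fderiv_right hk).clm_apply contDiff_const)

lemma hasCompactSupport_dVec (α : Fin 2) {F : QSpace n → Coeffs n} (hF : HasCompactSupport F) :
    HasCompactSupport (dVec α F) :=
  (hF.fderiv (𝕜 := ℝ)).mono fun q hq h => hq (by simp [dVec, h])

lemma isTestForm_iff {η : Form n} : IsTestForm η ↔
    ContDiff ℝ ((⊤ : ℕ∞) : WithTop ℕ∞) (fun q I => η I q) ∧
      HasCompactSupport fun q I => η I q := by
  refine ⟨fun h => ⟨contDiff_pi.2 fun I => (h I).1, ?_⟩,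
    fun h I => ⟨contDiff_pi.1 h.1 I, h.2.comp_left (g := fun v : Coeffs n => v I) rfl⟩⟩
  refine HasCompactSupport.of_support_subset_isCompact
    (isCompact_iUnion fun I => (h I).2.isCompact) fun q hq => ?_
  obtain ⟨I, hI⟩ := Function.ne_iff.1 hq
  exact Set.mem_iUnion.2 ⟨I, subset_tsupport _ hI⟩

lemma IsTestForm.d_eq (α : Fin 2) {η : Form n} (hη : IsTestForm η) :
    d α η = fun I q => dVec α (fun q I => η I q) q I :=
  d_eq_dVec α ((isTestForm_iff.1 hη).1.differentiable (by simp))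

lemma IsTestForm.d (α : Fin 2) {η : Form n} (hη : IsTestForm η) : IsTestForm (d α η) := by
  rw [hη.d_eq, isTestForm_iff]
  obtain ⟨hsmooth, hsupp⟩ := isTestForm_iff.1 hη
  exact ⟨contDiff_dVec α hsmooth (by simp), hasCompactSupport_dVec α hsupp⟩

lemma IsTestForm.baston {η : Form n} (hη : IsTestForm η) : IsTestForm (baston η) :=
  (hη.d 1).d 0

lemma wedgeSign_mul_sign {k : Fin (n * 2)} {I : Finset (Fin (n * 2))} (hk : k ∉ I) :
    wedgeSign I * (-1 : ℂ) ^ (Iᶜ.filter (· < k)).card =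
      (-1 : ℂ) ^ I.card *
        (wedgeSign (insert k I) * (-1 : ℂ) ^ ((insert k I).filter (· < k)).card) := by
  have hc : Iᶜ = insert k (insert k I)ᶜ := by
    ext i; by_cases h : i = k <;> simp [h, hk]
  have hkc : k ∉ (insert k I)ᶜ := by simp
  have hI : ∏ i ∈ I, (if k < i then (-1 : ℂ) else 1) =
      (-1 : ℂ) ^ I.card * ∏ i ∈ I, (if i < k then (-1 : ℂ) else 1) := by
    rw [← Finset.prod_const, ← Finset.prod_mul_distrib]
    refine Finset.prod_congr rfl fun i hi => ?_
    have hne : i ≠ k := fun e => hk (e ▸ hi)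
    rcases hne.lt_or_gt with h | h <;> simp [h, h.not_gt]
  simp only [wedgeSign, ← Finset.prod_const, Finset.prod_filter, Finset.prod_product,
    Finset.prod_insert hk]
  rw [hc]
  simp only [Finset.prod_insert hkc, Finset.prod_mul_distrib, lt_irrefl, if_false, one_mul]
  rw [hI, Finset.prod_const]
  ring

/-- The coefficient of `ω^0 ∧ … ∧ ω^{2n-1}` in `v ∧ w`. -/
def wedgeTop : Coeffs n →L[ℝ] Coeffs n →L[ℝ] ℂ :=
  (LinearMap.mk₂ ℝ (fun v w => ∑ I, wedgeSign I * (v I * w Iᶜ))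
    (fun _ _ _ => by simp [mul_add, add_mul, Finset.sum_add_distrib])
    (fun _ _ _ => by
      simp only [Pi.smul_apply, smul_mul_assoc, mul_smul_comm, Finset.smul_sum])
    (fun _ _ _ => by simp [mul_add, Finset.sum_add_distrib])
    (fun _ _ _ => by
      simp only [Pi.smul_apply, mul_smul_comm, Finset.smul_sum])).toContinuousBilinearMap

lemma wedgeTop_apply (v w : Coeffs n) : wedgeTop v w = ∑ I, wedgeSign I * (v I * w Iᶜ) := rfl

lemma wedgeTop_parity_wedgeLeft (k : Fin (n * 2)) (v w : Coeffs n) :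
    wedgeTop (parity v) (wedgeLeft k w) = wedgeTop (wedgeLeft k v) w := by
  simp only [wedgeTop_apply, wedgeLeft_apply, mul_ite, ite_mul, mul_zero, zero_mul,
    ← Finset.sum_filter]
  refine Finset.sum_bij' (fun I _ => insert k I) (fun I _ => I.erase k) ?_ ?_ ?_ ?_ ?_
  · simp
  · simp
  · intro I hI
    exact Finset.erase_insert (by simpa using hI)
  · intro I hI
    exact Finset.insert_erase (by simpa using hI)
  · intro I hI
    have hk : k ∉ I := by simpa using hI
    have hsign := wedgeSign_mul_sign hk
    have hsq : ((-1 : ℂ) ^ I.card) * (-1) ^ I.card = 1 := by rw [← mul_pow]; simp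
    rw [Finset.erase_insert hk, Finset.compl_insert, parity_apply]
    linear_combination (-1 : ℂ) ^ I.card * v I * w (Iᶜ.erase k) * hsign +
      (wedgeSign (insert k I) * (-1 : ℂ) ^ ((insert k I).filter (· < k)).card) *
        v I * w (Iᶜ.erase k) * hsq

lemma wedgeTop_parity_symbol (α : Fin 2) (q : QSpace n) (v w : Coeffs n) :
    wedgeTop (parity v) (symbol α q w) = wedgeTop (symbol α q v) w := by
  have hsmul (c : ℂ) (v w : Coeffs n) :
      wedgeTop v (c • w) = c • wedgeTop v w ∧ wedgeTop (c • v) w = c • wedgeTop v w := by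
    simp only [wedgeTop_apply, Pi.smul_apply, smul_mul_assoc, mul_smul_comm, Finset.smul_sum,
      and_self]
  simp only [symbol_apply, coordSymbol_apply, map_sum, map_smul, sum_apply, smul_apply, hsmul,
    wedgeTop_parity_wedgeLeft]

lemma integral_wedgeTop_dVec (α : Fin 2) {F H : QSpace n → Coeffs n} (hF : ContDiff ℝ 1 F)
    (hH : ContDiff ℝ 1 H) (hs : HasCompactSupport H) :
    ∫ q, wedgeTop (parity (F q)) (dVec α H q) = -∫ q, wedgeTop (dVec α F q) (H q) := by
  let B (p : Fin n × Fin 4) := wedgeTop.comp (symbol α (EuclideanSpace.single p 1))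
  have hpartial {G : QSpace n → Coeffs n} (hG : ContDiff ℝ 1 G) (r : QSpace n) :
      Continuous fun q => fderiv ℝ G q r :=
    (hG.continuous_fderiv one_ne_zero).clm_apply continuous_const
  have hint (p : Fin n × Fin 4) {G K : QSpace n → Coeffs n} (hG : Continuous G)
      (hK : Continuous K) (hKs : HasCompactSupport K) : Integrable fun q => B p (G q) (K q) := by
    refine Continuous.integrable_of_hasCompactSupport (by fun_prop) (hKs.mono fun q hq h => hq ?_)
    simp only [h, map_zero]
  have hF' (p : Fin n × Fin 4) := hint p (hpartial hF (EuclideanSpace.single p 1)) hH.continuous hs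
  have hH' (p : Fin n × Fin 4) := hint p hF.continuous (hpartial hH (EuclideanSpace.single p 1))
    (hs.fderiv_apply (𝕜 := ℝ) _)
  calc ∫ q, wedgeTop (parity (F q)) (dVec α H q)
      = ∑ p, ∫ q, B p (F q) (fderiv ℝ H q (EuclideanSpace.single p 1)) := by
        simp only [dVec, map_sum, wedgeTop_parity_symbol]
        exact integral_finsetSum _ fun p _ => hH' p
    _ = ∑ p, -∫ q, B p (fderiv ℝ F q (EuclideanSpace.single p 1)) (H q) :=
        Finset.sum_congr rfl fun p _ =>
          integral_bilinear_fderiv_right_eq_neg_left_of_integrable (hF' p) (hH' p)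
            (hint p hF.continuous hH.continuous hs)
            (fun q _ => hF.differentiable one_ne_zero q)
            (fun q _ => hH.differentiable one_ne_zero q)
    _ = -∫ q, wedgeTop (dVec α F q) (H q) := by
        rw [Finset.sum_neg_distrib, ← integral_finsetSum _ fun p _ => hF' p]
        simp only [dVec, map_sum, sum_apply, B, ContinuousLinearMap.comp_apply]

lemma locallyIntegrable_eval {m : Measure (QSpace n)} {F : QSpace n → Coeffs n}
    (hF : LocallyIntegrable F m) (I : Finset (Fin (n * 2))) :
    LocallyIntegrable (fun q => F q I) m := fun q =>
  let ⟨s, hs, hint⟩ := hF q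
  ⟨s, hs, Integrable.eval hint I⟩

lemma pairing_eq_integral_wedgeTop {m : Measure (QSpace n)} {F : QSpace n → Coeffs n}
    (hF : LocallyIntegrable F m) {η : Form n} (hη : IsTestForm η) :
    pairing m (fun I q => F q I) η = ∫ q, wedgeTop (F q) (fun I => η I q) ∂m := by
  simp only [pairing, wedgeTop_apply]
  have hint (I : Finset (Fin (n * 2))) : Integrable (fun q => F q I * η Iᶜ q) m :=
    LocallyIntegrable.integrable_smul_right_of_hasCompactSupport
      (locallyIntegrable_eval hF I)
      (hη Iᶜ).1.continuous (hη Iᶜ).2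
  rw [integral_finsetSum _ fun I _ => (hint I).const_mul _]
  simp only [integral_const_mul]

end VectorForms

/-! ### The powers of the regularised function -/

section Regularised

variable {n : ℕ}

/-- `-u_ε`, where `u_ε q = -1 / (‖q‖² + ε)` is the regularisation of `-1 / ‖q‖²`. -/
def regInv (ε : ℝ) (q : QSpace n) : ℝ := (‖q‖ ^ 2 + ε)⁻¹

/-- The form `(△u_ε)^k`, for `ε = 0` as a locally integrable form. -/
def powVec (k : ℕ) (ε : ℝ) (q : QSpace n) : Coeffs n :=
  (8 : ℝ) ^ k • (regInv ε q ^ (2 * k) • (wedgeBeta Finset.univ ^ k) (vac n) -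
    (k * regInv ε q ^ (2 * k + 1)) •
      symbol 0 q (symbol 1 q ((wedgeBeta Finset.univ ^ (k - 1)) (vac n))))

/-- The form `d₀ (u_ε (△u_ε)^k)`. -/
def halfVec (k : ℕ) (ε : ℝ) (q : QSpace n) : Coeffs n :=
  (2 * 8 ^ k * regInv ε q ^ (2 * k + 2)) • symbol 0 q ((wedgeBeta Finset.univ ^ k) (vac n))

lemma contDiff_regInv {ε : ℝ} (hε : 0 < ε) {m : WithTop ℕ∞} :
    ContDiff ℝ m (regInv ε : QSpace n → ℝ) :=
  ((contDiff_norm_sq ℝ).add contDiff_const).inv fun q => by positivity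

lemma contDiff_regInv_pow_smul {ε : ℝ} (hε : 0 < ε) (p : ℕ) {m : WithTop ℕ∞}
    {F : QSpace n → Coeffs n} (hF : ContDiff ℝ m F) :
    ContDiff ℝ m fun q => regInv ε q ^ p • F q :=
  ((contDiff_regInv hε).pow p).smul hF

lemma contDiff_symbol (α : Fin 2) {m : WithTop ℕ∞} {F : QSpace n → Coeffs n}
    (hF : ContDiff ℝ m F) : ContDiff ℝ m fun q => symbol α q (F q) :=
  (symbol α).contDiff.clm_apply hF

lemma contDiff_powVec (k : ℕ) {ε : ℝ} (hε : 0 < ε) {m : WithTop ℕ∞} :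
    ContDiff ℝ m (powVec k ε : QSpace n → Coeffs n) := by
  have h2 := contDiff_regInv_pow_smul hε (2 * k + 1) (m := m) (contDiff_symbol 0 (contDiff_symbol 1
    (contDiff_const (c := (wedgeBeta Finset.univ ^ (k - 1)) (vac n)))))
  unfold powVec
  simp only [mul_smul]
  exact ((contDiff_regInv_pow_smul hε _ contDiff_const).sub (h2.const_smul _)).const_smul _

lemma contDiff_halfVec (k : ℕ) {ε : ℝ} (hε : 0 < ε) {m : WithTop ℕ∞} :
    ContDiff ℝ m (halfVec k ε : QSpace n → Coeffs n) := by
  unfold halfVec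
  simp only [mul_smul]
  exact ((contDiff_regInv_pow_smul hε _ (contDiff_symbol 0 contDiff_const)).const_smul _).const_smul
    _

lemma dVec_regInv_pow_smul (α : Fin 2) {ε : ℝ} (hε : 0 < ε) (p : ℕ) {F : QSpace n → Coeffs n}
    {q : QSpace n} (hF : DifferentiableAt ℝ F q) :
    dVec α (fun q => regInv ε q ^ p • F q) q =
      regInv ε q ^ p • dVec α F q - (2 * p * regInv ε q ^ (p + 1)) • symbol α q (F q) := by
  have hpos : ‖q‖ ^ 2 + ε ≠ 0 := by positivity
  have hφ : HasDerivAt (fun x : ℝ => (x + ε)⁻¹ ^ p) (-(p * regInv ε q ^ (p + 1))) (‖q‖ ^ 2) := by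
    refine ((((hasDerivAt_id (‖q‖ ^ 2)).add_const ε).fun_inv hpos).fun_pow p).congr_deriv ?_
    cases p with
    | zero => simp
    | succ p =>
      simp only [regInv, id, Nat.add_sub_cancel, neg_div, one_div, ← inv_pow]
      ring
  refine (dVec_radial_smul α hφ hF).trans ?_
  change regInv ε q ^ p • dVec α F q + _ = _
  module

lemma dVec_symbol_const (α β : Fin 2) (v : Coeffs n) (q : QSpace n) :
    dVec α (fun q => symbol β q v) q = ∑ p, coordSymbol α p (coordSymbol β p v) := by
  rw [dVec_symbol α β (differentiableAt_const v), dVec_const, map_zero, sub_zero]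

lemma dVec_zero_symbol_symbol (w : Coeffs n) (q : QSpace n) :
    dVec 0 (fun q => symbol 0 q (symbol 1 q w)) q =
      -(4 : ℝ) • symbol 0 q (wedgeBeta Finset.univ w) := by
  rw [dVec_symbol 0 0 ((contDiff_symbol 1 contDiff_const).differentiable one_ne_zero q),
    dVec_symbol_const, sum_coordSymbol_self, sum_coordSymbol_zero_one, zero_sub, map_smul, neg_smul]

lemma dVec_zero_neg_regInv_smul_powVec (k : ℕ) {ε : ℝ} (hε : 0 < ε) (q : QSpace n) :
    dVec 0 (fun q => -regInv ε q • powVec k ε q) q = halfVec k ε q := by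
  set v := (wedgeBeta Finset.univ ^ k) (vac n) with hv
  set w := (wedgeBeta Finset.univ ^ (k - 1)) (vac n) with hw
  have hsplit : (fun q => -regInv ε q • powVec k ε q) = fun q =>
      ((8 : ℝ) ^ k * k) • (regInv ε q ^ (2 * k + 2) • symbol 0 q (symbol 1 q w)) -
        (8 : ℝ) ^ k • (regInv ε q ^ (2 * k + 1) • v) := by
    ext q : 1
    simp only [powVec, ← hv, ← hw]
    module
  have hv' : (k : ℝ) • wedgeBeta Finset.univ w = (k : ℝ) • v := by
    cases k with
    | zero => simp
    | succ k => rw [hv, hw, pow_succ', Module.End.mul_apply, Nat.add_sub_cancel]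
  have hsymbol : (k : ℝ) • symbol 0 q (wedgeBeta Finset.univ w) = (k : ℝ) • symbol 0 q v := by
    rw [← map_smul, hv', map_smul]
  have hγγ : ContDiff ℝ 1 fun q : QSpace n => symbol 0 q (symbol 1 q w) :=
    contDiff_symbol 0 (contDiff_symbol 1 contDiff_const)
  have h1 : ContDiff ℝ 1 fun q : QSpace n =>
      regInv ε q ^ (2 * k + 2) • symbol 0 q (symbol 1 q w) :=
    contDiff_regInv_pow_smul hε _ hγγ
  have h2 : ContDiff ℝ 1 fun q : QSpace n => regInv ε q ^ (2 * k + 1) • v :=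
    contDiff_regInv_pow_smul hε _ contDiff_const
  have h1' := h1.differentiable one_ne_zero q
  have h2' := h2.differentiable one_ne_zero q
  rw [hsplit, dVec_sub 0 (h1'.fun_const_smul _) (h2'.fun_const_smul _), dVec_const_smul 0 _ h1',
    dVec_const_smul 0 _ h2',
    dVec_regInv_pow_smul 0 hε _ (hγγ.differentiable one_ne_zero q),
    dVec_regInv_pow_smul 0 hε _ (differentiableAt_const v), dVec_zero_symbol_symbol,
    symbol_symbol_self, dVec_const, halfVec, ← hv]
  push_cast
  linear_combination (norm := module) (-4 * 8 ^ k * regInv ε q ^ (2 * k + 2) : ℝ) • hsymbol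

lemma dVec_one_halfVec (k : ℕ) {ε : ℝ} (hε : 0 < ε) (q : QSpace n) :
    dVec 1 (halfVec k ε) q = -powVec (k + 1) ε q := by
  set v := (wedgeBeta Finset.univ ^ k) (vac n) with hv
  have hβ : (wedgeBeta Finset.univ ^ (k + 1)) (vac n) = wedgeBeta Finset.univ v := by
    rw [pow_succ', Module.End.mul_apply]
  have hsplit : (halfVec k ε : QSpace n → Coeffs n) = fun q =>
      ((2 : ℝ) * 8 ^ k) • (regInv ε q ^ (2 * k + 2) • symbol 0 q v) := by
    ext q : 1
    rw [halfVec, mul_smul]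
  have hγ : ContDiff ℝ 1 fun q : QSpace n => symbol 0 q v := contDiff_symbol 0 contDiff_const
  rw [hsplit, dVec_const_smul 1 _
    ((contDiff_regInv_pow_smul hε _ hγ).differentiable one_ne_zero q),
    dVec_regInv_pow_smul 1 hε _ (hγ.differentiable one_ne_zero q), dVec_symbol_const,
    sum_coordSymbol_one_zero, symbol_anticomm 1 0, powVec, hβ, Nat.add_sub_cancel, ← hv]
  push_cast
  module

lemma parity_powVec (k : ℕ) (ε : ℝ) (q : QSpace n) : parity (powVec k ε q) = powVec k ε q := by
  simp only [powVec, LinearMap.map_smul_of_tower, map_sub, parity_symbol, map_neg, neg_neg,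
    parity_wedgeBeta_pow_vac]

lemma parity_halfVec (k : ℕ) (ε : ℝ) (q : QSpace n) : parity (halfVec k ε q) = -halfVec k ε q := by
  simp only [halfVec, LinearMap.map_smul_of_tower, parity_symbol, parity_wedgeBeta_pow_vac,
    smul_neg]

lemma pairing_regularised (k : ℕ) {ε : ℝ} (hε : 0 < ε) {η : Form n} (hη : IsTestForm η) :
    pairing volume (fun I q => (-regInv ε q • powVec k ε q) I) (baston η) =
      pairing volume (fun I q => powVec (k + 1) ε q I) η := by
  set H : QSpace n → Coeffs n := fun q I => η I q
  obtain ⟨hH, hHs⟩ := isTestForm_iff.1 hη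
  have hF : ContDiff ℝ 1 fun q : QSpace n => -regInv ε q • powVec k ε q :=
    (contDiff_regInv hε).neg.smul (contDiff_powVec k hε)
  have hd0 := integral_wedgeTop_dVec 0 hF (contDiff_dVec 1 hH (k := 1) (by norm_cast))
    (hasCompactSupport_dVec 1 hHs)
  have hd1 := integral_wedgeTop_dVec 1 (contDiff_halfVec k hε) (hH.of_le (by norm_cast)) hHs
  have hbaston (q : QSpace n) : (fun I => baston η I q) = dVec 0 (dVec 1 H) q := by
    rw [baston, (hη.d 1).d_eq, hη.d_eq]
  simp only [dVec_zero_neg_regInv_smul_powVec k hε, LinearMap.map_smul_of_tower,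
    parity_powVec] at hd0
  simp only [dVec_one_halfVec k hε, parity_halfVec, map_neg, neg_apply,
    integral_neg, neg_neg] at hd1
  rw [pairing_eq_integral_wedgeTop hF.continuous.locallyIntegrable hη.baston,
    pairing_eq_integral_wedgeTop (contDiff_powVec (m := 1) _ hε).continuous.locallyIntegrable hη]
  simp only [hbaston]
  rw [hd0, hd1]

lemma powVec_self (hn : 0 < n) {ε : ℝ} (hε : 0 < ε) (q : QSpace n) :
    powVec n ε q = (8 ^ n * n.factorial * (ε * regInv ε q ^ (2 * n + 1))) • vol n := by
  have hcancel : regInv ε q ^ (2 * n) = regInv ε q ^ (2 * n + 1) * (‖q‖ ^ 2 + ε) := by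
    rw [pow_succ, mul_assoc, regInv, inv_mul_cancel₀ (by positivity), mul_one]
  have hfactorial : (n.factorial : ℝ) = n * (n - 1).factorial :=
    mod_cast (Nat.mul_factorial_pred hn.ne').symm
  have hcast (m : ℕ) : (m : ℂ) • vol n = (m : ℝ) • vol n := by
    rw [Nat.cast_smul_eq_nsmul, Nat.cast_smul_eq_nsmul]
  rw [powVec, symbol_symbol_wedgeBeta_univ_pow, wedgeBeta_univ_pow, hcancel, hcast, hcast,
    hfactorial]
  module

end Regularised

/-! ### The limit `ε → 0` -/

section AddHaar

variable {E : Type*} [NormedAddCommGroup E] [NormedSpace ℝ E] [FiniteDimensional ℝ E]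
  [MeasurableSpace E] [BorelSpace E] (μ : Measure E) [μ.IsAddHaarMeasure]

lemma locallyIntegrable_inv_norm_pow {p : ℕ} (hp : p < Module.finrank ℝ E) :
    LocallyIntegrable (fun x : E => ‖x‖⁻¹ ^ p) μ := by
  have : Nontrivial E := Module.nontrivial_of_finrank_pos (R := ℝ) (by omega)
  rw [locallyIntegrable_iff]
  intro K hK
  obtain ⟨r, hr⟩ := hK.isBounded.subset_ball (0 : E)
  refine IntegrableOn.mono_set ?_ hr
  rw [integrableOn_fun_norm_addHaar μ (f := fun y => y⁻¹ ^ p) (r := r)]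
  have hcont : ContinuousOn (fun y : ℝ => y ^ (Module.finrank ℝ E - 1 - p)) (Set.Icc 0 r) := by
    fun_prop
  refine (hcont.integrableOn_Icc.mono_set Set.Ioo_subset_Icc_self).congr_fun ?_ measurableSet_Ioo
  intro y hy
  have hpow : y ^ (Module.finrank ℝ E - 1) = y ^ (Module.finrank ℝ E - 1 - p) * y ^ p := by
    rw [← pow_add]
    congr 1
    omega
  simp only [smul_eq_mul]
  rw [hpow, mul_assoc, ← mul_pow, mul_inv_cancel₀ hy.1.ne', one_pow, mul_one]

lemma locallyIntegrable_of_norm_le_inv_norm_pow {G : Type*} [NormedAddCommGroup G] {p : ℕ}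
    (hp : p < Module.finrank ℝ E) {F : E → G} (hF : AEStronglyMeasurable F μ) {C : ℝ}
    (hC : ∀ x, x ≠ 0 → ‖F x‖ ≤ C * ‖x‖⁻¹ ^ p) : LocallyIntegrable F μ := by
  have : Nontrivial E := Module.nontrivial_of_finrank_pos (R := ℝ) (by omega)
  refine ((locallyIntegrable_inv_norm_pow μ hp).smul C).mono hF ?_
  filter_upwards [Measure.ae_ne μ 0] with x hx
  exact (hC x hx).trans (le_abs_self _)

end AddHaar

section Limit

variable {n : ℕ}

lemma finrank_qSpace (n : ℕ) : Module.finrank ℝ (QSpace n) = 4 * n := by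
  simp [mul_comm]

lemma nontrivial_qSpace (hn : 0 < n) : Nontrivial (QSpace n) :=
  Module.nontrivial_of_finrank_pos (R := ℝ) (by rw [finrank_qSpace]; omega)

lemma tendsto_pairing {p : ℕ} (hp : p < 4 * n) {F : ℝ → QSpace n → Coeffs n} {C : ℝ}
    (hF : ∀ ε, Measurable (F ε)) (hC : ∀ ε, 0 ≤ ε → ∀ q, q ≠ 0 → ‖F ε q‖ ≤ C * ‖q‖⁻¹ ^ p)
    (hlim : ∀ q, q ≠ 0 → Tendsto (fun ε => F ε q) (𝓝[>] 0) (𝓝 (F 0 q)))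
    {η : Form n} (hη : IsTestForm η) :
    Tendsto (fun ε => pairing volume (fun I q => F ε q I) η) (𝓝[>] 0)
      (𝓝 (pairing volume (fun I q => F 0 q I) η)) := by
  have := nontrivial_qSpace (n := n) (by omega)
  have hp' : p < Module.finrank ℝ (QSpace n) := by rwa [finrank_qSpace]
  have hpairing (ε : ℝ) (hε : 0 ≤ ε) : pairing volume (fun I q => F ε q I) η =
      ∫ q, wedgeTop (F ε q) (fun I => η I q) :=
    pairing_eq_integral_wedgeTop (locallyIntegrable_of_norm_le_inv_norm_pow volume hp'
      (hF ε).aestronglyMeasurable (hC ε hε)) hη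
  obtain ⟨hsmooth, hsupp⟩ := isTestForm_iff.1 hη
  set H : QSpace n → Coeffs n := fun q I => η I q
  have hpos : ∀ᶠ ε : ℝ in 𝓝[>] 0, 0 ≤ ε := by
    filter_upwards [self_mem_nhdsWithin] with ε hε using le_of_lt hε
  rw [hpairing 0 le_rfl]
  refine Tendsto.congr' (hpos.mono fun ε hε => (hpairing ε hε).symm) ?_
  refine tendsto_integral_filter_of_dominated_convergence
    (fun q => ‖(wedgeTop : Coeffs n →L[ℝ] _)‖ * C * (‖q‖⁻¹ ^ p * ‖H q‖)) ?_ ?_ ?_ ?_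
  · exact Eventually.of_forall fun ε => wedgeTop.aestronglyMeasurable_comp₂
      (hF ε).aestronglyMeasurable hsmooth.continuous.aestronglyMeasurable
  · filter_upwards [hpos] with ε hε
    filter_upwards [Measure.ae_ne volume 0] with q hq
    refine (wedgeTop.le_opNorm₂ _ _).trans ?_
    rw [mul_assoc _ C, ← mul_assoc C, ← mul_assoc]
    gcongr
    exact hC ε hε q hq
  · exact ((locallyIntegrable_inv_norm_pow volume hp').integrable_smul_right_of_hasCompactSupport
      hsmooth.continuous.norm hsupp.norm).const_mul _
  · filter_upwards [Measure.ae_ne volume 0] with q hq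
    exact (wedgeTop.flip (H q)).continuous.tendsto _ |>.comp (hlim q hq)

lemma abs_regInv_le {ε : ℝ} (hε : 0 ≤ ε) {q : QSpace n} (hq : q ≠ 0) :
    |regInv ε q| ≤ ‖q‖⁻¹ ^ 2 := by
  have : 0 < ‖q‖ := norm_pos_iff.2 hq
  rw [regInv, abs_of_nonneg (by positivity), inv_pow]
  gcongr
  linarith

lemma exists_norm_symbol_symbol_le (w : Coeffs n) : ∃ C, 0 ≤ C ∧ ∀ q : QSpace n,
    ‖symbol 0 q (symbol 1 q w)‖ ≤ C * ‖q‖ ^ 2 := by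
  refine ⟨‖symbol (n := n) 0‖ * (‖symbol (n := n) 1‖ * ‖w‖), by positivity, fun q => ?_⟩
  calc ‖symbol 0 q (symbol 1 q w)‖
      ≤ ‖symbol (n := n) 0‖ * ‖q‖ * (‖symbol (n := n) 1‖ * ‖q‖ * ‖w‖) :=
        ((symbol 0).le_opNorm₂ _ _).trans <| by
          gcongr
          exact (symbol 1).le_opNorm₂ q w
    _ = _ := by ring

lemma exists_norm_powVec_le (n k : ℕ) : ∃ C, 0 ≤ C ∧ ∀ ε, 0 ≤ ε → ∀ q : QSpace n, q ≠ 0 →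
    ‖powVec k ε q‖ ≤ C * ‖q‖⁻¹ ^ (4 * k) := by
  set v := (wedgeBeta Finset.univ ^ k) (vac n)
  set w := (wedgeBeta Finset.univ ^ (k - 1)) (vac n)
  obtain ⟨c, hc, hsymbol⟩ := exists_norm_symbol_symbol_le w
  refine ⟨8 ^ k * (‖v‖ + k * c), by positivity, fun ε hε q hq => ?_⟩
  have hnorm : ‖q‖ ≠ 0 := norm_ne_zero_iff.2 hq
  have hreg := abs_regInv_le hε hq
  calc ‖powVec k ε q‖
      ≤ 8 ^ k * (|regInv ε q| ^ (2 * k) * ‖v‖ +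
          k * |regInv ε q| ^ (2 * k + 1) * ‖symbol 0 q (symbol 1 q w)‖) := by
        rw [powVec, norm_smul, norm_pow, Real.norm_ofNat]
        gcongr
        refine (norm_sub_le _ _).trans_eq ?_
        rw [norm_smul, norm_smul, norm_pow, norm_mul, norm_pow, Real.norm_eq_abs,
          RCLike.norm_natCast]
    _ ≤ 8 ^ k * ((‖q‖⁻¹ ^ 2) ^ (2 * k) * ‖v‖ +
          k * (‖q‖⁻¹ ^ 2) ^ (2 * k + 1) * (c * ‖q‖ ^ 2)) := by
        gcongr
        exact hsymbol q
    _ = 8 ^ k * (‖v‖ + k * c) * ‖q‖⁻¹ ^ (4 * k) := by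
        have hcancel : ‖q‖⁻¹ ^ 2 * ‖q‖ ^ 2 = 1 := by
          rw [← mul_pow, inv_mul_cancel₀ hnorm, one_pow]
        linear_combination 8 ^ k * k * c * ‖q‖⁻¹ ^ (4 * k) * hcancel

lemma measurable_regInv (ε : ℝ) : Measurable (regInv ε : QSpace n → ℝ) := by
  unfold regInv
  fun_prop

lemma measurable_powVec (k : ℕ) (ε : ℝ) : Measurable (powVec k ε : QSpace n → Coeffs n) := by
  have hsymbol : Measurable fun q : QSpace n =>
      symbol 0 q (symbol 1 q ((wedgeBeta Finset.univ ^ (k - 1)) (vac n))) :=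
    (contDiff_symbol (m := 0) 0 (contDiff_symbol 1 contDiff_const)).continuous.measurable
  exact ((((measurable_regInv ε).pow_const _).smul_const _).sub
    ((((measurable_regInv ε).pow_const _).const_mul _).smul hsymbol)).const_smul ((8 : ℝ) ^ k)

lemma tendsto_regInv {q : QSpace n} (hq : q ≠ 0) :
    Tendsto (fun ε : ℝ => regInv ε q) (𝓝[>] 0) (𝓝 (regInv 0 q)) := by
  have hcont : ContinuousAt (fun ε : ℝ => regInv ε q) 0 := by
    unfold regInv
    have h : ‖q‖ ^ 2 + 0 ≠ 0 := by simpa using hq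
    fun_prop (disch := exact h)
  exact hcont.tendsto.mono_left nhdsWithin_le_nhds

lemma tendsto_powVec (k : ℕ) {q : QSpace n} (hq : q ≠ 0) :
    Tendsto (fun ε : ℝ => powVec k ε q) (𝓝[>] 0) (𝓝 (powVec k 0 q)) :=
  ((((tendsto_regInv hq).pow _).smul_const _).sub
    ((((tendsto_regInv hq).pow _).const_mul _).smul_const _)).const_smul _

lemma tendsto_pairing_powVec {k : ℕ} (hk : k < n) {η : Form n} (hη : IsTestForm η) :
    Tendsto (fun ε => pairing volume (fun I q => powVec k ε q I) η) (𝓝[>] 0)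
      (𝓝 (pairing volume (fun I q => powVec k 0 q I) η)) := by
  obtain ⟨C, -, hC⟩ := exists_norm_powVec_le n k
  exact tendsto_pairing (p := 4 * k) (by omega) (measurable_powVec k) hC
    (fun q hq => tendsto_powVec k hq) hη

lemma exists_norm_regInv_smul_powVec_le (n k : ℕ) : ∃ C, ∀ ε, 0 ≤ ε → ∀ q : QSpace n, q ≠ 0 →
    ‖-regInv ε q • powVec k ε q‖ ≤ C * ‖q‖⁻¹ ^ (4 * k + 2) := by
  obtain ⟨C, _, h⟩ := exists_norm_powVec_le n k
  refine ⟨C, fun ε hε q hq => ?_⟩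
  calc ‖-regInv ε q • powVec k ε q‖ = |regInv ε q| * ‖powVec k ε q‖ := by
        rw [norm_smul, norm_neg, Real.norm_eq_abs]
    _ ≤ ‖q‖⁻¹ ^ 2 * (C * ‖q‖⁻¹ ^ (4 * k)) := by
        gcongr
        · exact abs_regInv_le hε hq
        · exact h ε hε q hq
    _ = C * ‖q‖⁻¹ ^ (4 * k + 2) := by ring

lemma measurable_regInv_smul_powVec (k : ℕ) (ε : ℝ) :
    Measurable fun q : QSpace n => -regInv ε q • powVec k ε q :=
  (measurable_regInv ε).neg.smul (measurable_powVec k ε)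

lemma tendsto_pairing_regInv_smul_powVec {k : ℕ} (hk : k < n) {η : Form n} (hη : IsTestForm η) :
    Tendsto (fun ε => pairing volume (fun I q => (-regInv ε q • powVec k ε q) I) η) (𝓝[>] 0)
      (𝓝 (pairing volume (fun I q => (-regInv 0 q • powVec k 0 q) I) η)) := by
  obtain ⟨C, hC⟩ := exists_norm_regInv_smul_powVec_le n k
  exact tendsto_pairing (F := fun ε q => -regInv ε q • powVec k ε q) (p := 4 * k + 2) (by omega)
    (measurable_regInv_smul_powVec k) hC
    (fun q hq => (tendsto_regInv hq).neg.smul (tendsto_powVec k hq)) hη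

lemma pairing_powVec_succ {k : ℕ} (hk : k + 1 < n) {η : Form n} (hη : IsTestForm η) :
    pairing volume (fun I q => powVec (k + 1) 0 q I) η =
      pairing volume (fun I q => (-regInv 0 q • powVec k 0 q) I) (baston η) := by
  refine tendsto_nhds_unique (tendsto_pairing_powVec hk hη)
    ((tendsto_pairing_regInv_smul_powVec (by omega) hη.baston).congr' ?_)
  filter_upwards [self_mem_nhdsWithin] with ε hε
  exact pairing_regularised k hε hη

end Limit

/-! ### Concentration of the regularised Monge-Ampère measures -/

lemma tendsto_norm_pow_mul_inv_one_add_norm_sq_pow {E : Type*}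
    [NormedAddCommGroup E] (m : ℕ) :
    Tendsto (fun x : E => ‖x‖ ^ (2 * m) * (1 + ‖x‖ ^ 2)⁻¹ ^ (m + 1)) (Bornology.cobounded E)
      (𝓝 0) := by
  refine squeeze_zero (g := fun x => (1 + ‖x‖ ^ 2)⁻¹) (fun x => by positivity) (fun x => ?_)
    (tendsto_inv_atTop_zero.comp (tendsto_atTop_add_const_left _ _
      ((tendsto_pow_atTop two_ne_zero).comp tendsto_norm_cobounded_atTop)))
  calc ‖x‖ ^ (2 * m) * (1 + ‖x‖ ^ 2)⁻¹ ^ (m + 1)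
      = (‖x‖ ^ 2 * (1 + ‖x‖ ^ 2)⁻¹) ^ m * (1 + ‖x‖ ^ 2)⁻¹ := by ring
    _ ≤ 1 ^ m * (1 + ‖x‖ ^ 2)⁻¹ := by
        gcongr
        rw [← div_eq_mul_inv, div_le_one (by positivity)]
        linarith
    _ = (1 + ‖x‖ ^ 2)⁻¹ := by rw [one_pow, one_mul]

section PointMass

variable {E : Type*} [NormedAddCommGroup E] [NormedSpace ℝ E] [FiniteDimensional ℝ E]
  [MeasurableSpace E] [BorelSpace E] (μ : Measure E) [μ.IsAddHaarMeasure]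

lemma integral_Ioi_pow_mul_inv_one_add_sq_pow {m : ℕ} (hm : 0 < m) :
    ∫ y in Set.Ioi (0 : ℝ), y ^ (2 * m - 1) * (1 + y ^ 2)⁻¹ ^ (m + 1) = (2 * m : ℝ)⁻¹ := by
  have hderiv (x : ℝ) : HasDerivAt (fun y : ℝ => (y ^ 2 * (1 + y ^ 2)⁻¹) ^ m / (2 * m))
      (x ^ (2 * m - 1) * (1 + x ^ 2)⁻¹ ^ (m + 1)) x := by
    have hx : 1 + x ^ 2 ≠ 0 := by positivity
    have hsq : HasDerivAt (fun y : ℝ => y ^ 2) (2 * x) x := by simpa using hasDerivAt_pow 2 x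
    refine ((hsq.fun_mul ((hsq.const_add 1).fun_inv hx)).fun_pow m |>.div_const _).congr_deriv ?_
    obtain ⟨k, rfl⟩ : ∃ k, m = k + 1 := ⟨m - 1, by omega⟩
    have hk : 2 * (k + 1) - 1 = 2 * k + 1 := by omega
    rw [hk, Nat.add_sub_cancel, mul_pow, add_assoc k 1 1, pow_add (1 + x ^ 2)⁻¹ k]
    generalize (1 + x ^ 2)⁻¹ ^ k = t
    push_cast
    field_simp
    ring
  have hlim : Tendsto (fun y : ℝ => (y ^ 2 * (1 + y ^ 2)⁻¹) ^ m / (2 * m)) atTop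
      (𝓝 (2 * m : ℝ)⁻¹) := by
    have h1 : Tendsto (fun y : ℝ => 1 - (1 + y ^ 2)⁻¹) atTop (𝓝 (1 - 0)) :=
      tendsto_const_nhds.sub (tendsto_inv_atTop_zero.comp
        (tendsto_atTop_add_const_left _ _ (tendsto_pow_atTop two_ne_zero)))
    have h2 := (h1.pow m).div_const (2 * m : ℝ)
    rw [sub_zero, one_pow, one_div] at h2
    refine h2.congr fun y => ?_
    have hy : 1 + y ^ 2 ≠ 0 := by positivity
    congr 2
    field_simp
    ring
  rw [integral_Ioi_of_hasDerivAt_of_nonneg (hderiv 0).continuousAt.continuousWithinAt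
    (fun x _ => hderiv x) (fun x hx => ?_) hlim]
  · simp [hm.ne']
  · have : 0 < x := hx
    positivity

lemma integral_inv_one_add_norm_sq_pow {m : ℕ} (hm : 0 < m) (hE : Module.finrank ℝ E = 2 * m) :
    ∫ x, (1 + ‖x‖ ^ 2)⁻¹ ^ (m + 1) ∂μ = μ.real (Metric.ball 0 1) := by
  have : Nontrivial E := Module.nontrivial_of_finrank_pos (R := ℝ) (by omega)
  have hm' : (m : ℝ) ≠ 0 := by positivity
  rw [integral_fun_norm_addHaar μ (fun y => (1 + y ^ 2)⁻¹ ^ (m + 1)), hE]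
  simp only [smul_eq_mul]
  rw [integral_Ioi_pow_mul_inv_one_add_sq_pow hm, nsmul_eq_mul]
  push_cast
  field_simp

lemma tendsto_integral_mul_inv_norm_sq_add_pow_smul {G : Type*} [NormedAddCommGroup G]
    [NormedSpace ℝ G] [CompleteSpace G] {m : ℕ} (hm : 0 < m) (hE : Module.finrank ℝ E = 2 * m)
    {g : E → G} (hg : Integrable g μ) (hcont : ContinuousAt g 0) :
    Tendsto (fun ε : ℝ => ∫ x, (ε * (‖x‖ ^ 2 + ε)⁻¹ ^ (m + 1)) • g x ∂μ) (𝓝[>] 0)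
      (𝓝 (μ.real (Metric.ball 0 1) • g 0)) := by
  set V := μ.real (Metric.ball (0 : E) 1)
  have hVpos : 0 < V := ENNReal.toReal_pos
    (Metric.measure_ball_pos μ 0 one_pos).ne' measure_ball_lt_top.ne
  have hpeak := tendsto_integral_comp_smul_smul_of_integrable (μ := μ)
    (φ := fun x => V⁻¹ * (1 + ‖x‖ ^ 2)⁻¹ ^ (m + 1)) (fun x => by positivity)
    (by rw [integral_const_mul, integral_inv_one_add_norm_sq_pow μ hm hE,
      inv_mul_cancel₀ hVpos.ne'])
    (by
      rw [hE]
      simpa only [mul_left_comm, mul_zero] using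
        (tendsto_norm_pow_mul_inv_one_add_norm_sq_pow (E := E) m).const_mul V⁻¹)
    hg hcont
  have hscale : Tendsto (fun ε : ℝ => (√ε)⁻¹) (𝓝[>] 0) atTop := by
    refine tendsto_inv_nhdsGT_zero.comp (tendsto_nhdsWithin_iff.2 ⟨?_, ?_⟩)
    · simpa using (Real.continuous_sqrt.tendsto 0).mono_left nhdsWithin_le_nhds
    · filter_upwards [self_mem_nhdsWithin] with ε hε using Real.sqrt_pos.2 hε
  refine ((hpeak.comp hscale).const_smul V).congr' ?_
  filter_upwards [self_mem_nhdsWithin] with ε hε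
  have hε : 0 < ε := hε
  have hsqrt : √ε ^ 2 = ε := Real.sq_sqrt hε.le
  rw [Function.comp_apply, ← integral_smul]
  refine integral_congr_ae (Eventually.of_forall fun x => ?_)
  simp only [smul_smul]
  congr 1
  have hdilate : 1 + ε⁻¹ * ‖x‖ ^ 2 = ε⁻¹ * (‖x‖ ^ 2 + ε) := by field_simp; ring
  rw [norm_smul, norm_inv, Real.norm_of_nonneg (Real.sqrt_nonneg _), hE, inv_pow, mul_pow,
    inv_pow √ε, pow_mul √ε, hsqrt, hdilate, mul_inv, inv_inv, mul_pow]
  field_simp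
  ring

end PointMass

section Mass

variable {n : ℕ}

/-- The total mass of the Monge-Ampère measure of `-1 / ‖q‖²`. -/
def maMass (n : ℕ) : ℝ := 8 ^ n * n.factorial * Real.pi ^ (2 * n) / (2 * n).factorial

lemma measureReal_ball_one (hn : 0 < n) :
    (volume : Measure (QSpace n)).real (Metric.ball 0 1) =
      Real.pi ^ (2 * n) / (2 * n).factorial := by
  have : Nonempty (Fin n × Fin 4) := ⟨⟨0, hn⟩, 0⟩
  have hcard : Fintype.card (Fin n × Fin 4) = 2 * (2 * n) := by simp; ring
  have hhalf : ((2 * (2 * n) : ℕ) : ℝ) / 2 + 1 = ((2 * n : ℕ) : ℝ) + 1 := by push_cast; ring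
  rw [Measure.real, EuclideanSpace.volume_ball, hcard, hhalf, Real.Gamma_nat_eq_factorial,
    pow_mul (√Real.pi), Real.sq_sqrt Real.pi_pos.le, ENNReal.ofReal_one, one_pow, one_mul,
    ENNReal.toReal_ofReal (by positivity)]

lemma wedgeTop_vol (w : Coeffs n) : wedgeTop (vol n) w = w ∅ := by
  simp [wedgeTop_apply, vol, Pi.single_apply, wedgeSign]

lemma tendsto_pairing_powVec_self (hn : 0 < n) {η : Form n} (hη : IsTestForm η) :
    Tendsto (fun ε => pairing volume (fun I q => powVec n ε q I) η) (𝓝[>] 0)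
      (𝓝 (maMass n * η ∅ 0)) := by
  have hcont := (hη ∅).1.continuous
  have h := (tendsto_integral_mul_inv_norm_sq_add_pow_smul (m := 2 * n) volume (by omega)
    (by rw [finrank_qSpace]; ring) (hcont.integrable_of_hasCompactSupport (hη ∅).2)
    hcont.continuousAt).const_smul ((8 : ℝ) ^ n * n.factorial)
  rw [measureReal_ball_one hn, smul_smul, ← mul_div_assoc, ← maMass, Complex.real_smul] at h
  refine h.congr' ?_
  filter_upwards [self_mem_nhdsWithin] with ε hε
  rw [pairing_eq_integral_wedgeTop (contDiff_powVec (m := 1) n hε).continuous.locallyIntegrable hη,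
    ← integral_smul]
  simp only [powVec_self hn hε, map_smul, smul_apply, wedgeTop_vol, regInv, mul_smul]

lemma pairing_regInv_smul_powVec_self {k : ℕ} {η : Form (k + 1)} (hη : IsTestForm η) :
    pairing volume (fun I q => (-regInv 0 q • powVec k 0 q) I) (baston η) =
      maMass (k + 1) * η ∅ 0 := by
  refine tendsto_nhds_unique ((tendsto_pairing_regInv_smul_powVec (by omega) hη.baston).congr' ?_)
    (tendsto_pairing_powVec_self k.succ_pos hη)
  filter_upwards [self_mem_nhdsWithin] with ε hε
  exact pairing_regularised k hε hη

end Mass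

/-! ### Uniqueness of currents of order zero -/

section TestFunctions

variable {E F : Type*} [NormedAddCommGroup F] [NormedSpace ℝ F] [MeasurableSpace E]

lemma locallyIntegrable_rnDeriv_smul [TopologicalSpace E] [T2Space E] [LocallyCompactSpace E]
    [OpensMeasurableSpace E] {m M : Measure E} [SigmaFinite m] [SigmaFinite M]
    (h : m ≪ M) {c : E → F} (hc : LocallyIntegrable c m) :
    LocallyIntegrable (fun q => (m.rnDeriv M q).toReal • c q) M := by
  rw [locallyIntegrable_iff] at hc ⊢
  intro K hK
  have hcK := hc K hK
  rw [← integrable_indicator_iff hK.measurableSet, ← integrable_rnDeriv_smul_iff h] at hcK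
  rw [← integrable_indicator_iff hK.measurableSet]
  simpa only [Set.indicator_smul] using hcK

lemma ae_rnDeriv_smul_eq_of_integral_contDiff_smul_eq [NormedAddCommGroup E] [NormedSpace ℝ E]
    [FiniteDimensional ℝ E] [BorelSpace E] [CompleteSpace F] {m m' : Measure E} [SigmaFinite m]
    [SigmaFinite m'] {c c' : E → F} (hc : LocallyIntegrable c m) (hc' : LocallyIntegrable c' m')
    (h : ∀ g : E → ℝ, ContDiff ℝ ((⊤ : ℕ∞) : WithTop ℕ∞) g → HasCompactSupport g →
      ∫ q, g q • c q ∂m = ∫ q, g q • c' q ∂m') :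
    ∀ᵐ q ∂(m + m'), (m.rnDeriv (m + m') q).toReal • c q =
      (m'.rnDeriv (m + m') q).toReal • c' q := by
  have hm : m ≪ m + m' := Measure.absolutelyContinuous_of_le (Measure.le_add_right le_rfl)
  have hm' : m' ≪ m + m' := Measure.absolutelyContinuous_of_le (Measure.le_add_left le_rfl)
  refine ae_eq_of_integral_contDiff_smul_eq (locallyIntegrable_rnDeriv_smul hm hc)
    (locallyIntegrable_rnDeriv_smul hm' hc') fun g hg hs => ?_
  simp only [smul_comm (g _) (ENNReal.toReal _)]
  rw [integral_rnDeriv_smul hm, integral_rnDeriv_smul hm', h g hg hs]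

lemma measure_eq_of_integral_contDiff_eq [NormedAddCommGroup E] [NormedSpace ℝ E]
    [FiniteDimensional ℝ E] [BorelSpace E] {μ ν : Measure E} [IsLocallyFiniteMeasure μ]
    [IsLocallyFiniteMeasure ν]
    (h : ∀ g : E → ℝ, ContDiff ℝ ((⊤ : ℕ∞) : WithTop ℕ∞) g → HasCompactSupport g →
      ∫ q, g q ∂μ = ∫ q, g q ∂ν) : μ = ν := by
  have hμ : μ ≪ μ + ν := Measure.absolutelyContinuous_of_le (Measure.le_add_right le_rfl)
  have hν : ν ≪ μ + ν := Measure.absolutelyContinuous_of_le (Measure.le_add_left le_rfl)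
  have hae := ae_rnDeriv_smul_eq_of_integral_contDiff_smul_eq (m := μ) (m' := ν)
    (c := fun _ => (1 : ℝ)) (c' := fun _ => (1 : ℝ)) (locallyIntegrable_const 1)
    (locallyIntegrable_const 1) (by simpa only [smul_eq_mul, mul_one] using h)
  refine (Measure.withDensity_rnDeriv_eq _ _ hμ).symm.trans
    (Eq.trans (withDensity_congr_ae ?_) (Measure.withDensity_rnDeriv_eq _ _ hν))
  filter_upwards [hae, μ.rnDeriv_ne_top (μ + ν), ν.rnDeriv_ne_top (μ + ν)] with q hq hμq hνq
  rw [← ENNReal.toReal_eq_toReal_iff' hμq hνq]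
  simpa only [smul_eq_mul, mul_one] using hq

end TestFunctions

section Currents

variable {n : ℕ}

/-- The form `g ω^J`. -/
def singleForm (J : Finset (Fin (n * 2))) (g : QSpace n → ℂ) : Form n := Pi.single J g

lemma isTestForm_singleForm (J : Finset (Fin (n * 2))) {g : QSpace n → ℝ}
    (hg : ContDiff ℝ ((⊤ : ℕ∞) : WithTop ℕ∞) g) (hs : HasCompactSupport g) :
    IsTestForm (singleForm J fun q => (g q : ℂ)) := by
  intro I
  unfold singleForm
  by_cases h : I = J
  · subst h
    rw [Pi.single_eq_same]
    exact ⟨Complex.ofRealCLM.contDiff.comp hg, hs.comp_left (g := Complex.ofReal) (by simp)⟩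
  · rw [Pi.single_eq_of_ne h]
    exact ⟨contDiff_const, HasCompactSupport.zero⟩

lemma pairing_singleForm (m : Measure (QSpace n)) (c : Form n) (I : Finset (Fin (n * 2)))
    (g : QSpace n → ℂ) :
    pairing m c (singleForm Iᶜ g) = wedgeSign I * ∫ q, c I q * g q ∂m := by
  unfold pairing singleForm
  rw [Finset.sum_eq_single I (fun J _ hJ => ?_) (by simp), Pi.single_eq_same]
  simp [Pi.single_eq_of_ne (compl_injective.ne hJ)]

lemma RadonCurrent.mulApply_eq_of_apply_eq {T T' : RadonCurrent n}
    (h : ∀ η : Form n, IsTestForm η → T.apply η = T'.apply η) (u : QSpace n → EReal)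
    (η : Form n) : T.mulApply u η = T'.mulApply u η := by
  have := T.locallyFinite
  have := T'.locallyFinite
  have hT : T.base ≪ T.base + T'.base :=
    Measure.absolutelyContinuous_of_le (Measure.le_add_right le_rfl)
  have hT' : T'.base ≪ T.base + T'.base :=
    Measure.absolutelyContinuous_of_le (Measure.le_add_left le_rfl)
  unfold RadonCurrent.mulApply pairing
  refine Finset.sum_congr rfl fun I _ => congrArg (wedgeSign I * ·) ?_
  have hsign : wedgeSign I ≠ 0 := pow_ne_zero _ (by simp)
  have hae := ae_rnDeriv_smul_eq_of_integral_contDiff_smul_eq (T.locallyIntegrable I)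
    (T'.locallyIntegrable I) fun g hg hs => by
      have hg := h _ (isTestForm_singleForm Iᶜ hg hs)
      rw [RadonCurrent.apply, RadonCurrent.apply, pairing_singleForm, pairing_singleForm] at hg
      simpa only [Complex.real_smul, mul_comm] using mul_left_cancel₀ hsign hg
  rw [← integral_rnDeriv_smul hT, ← integral_rnDeriv_smul hT']
  refine integral_congr_ae ?_
  filter_upwards [hae] with q hq
  rw [mul_assoc, mul_assoc, mul_left_comm, mul_left_comm _ (T'.coeff I q), ← smul_mul_assoc, hq,
    smul_mul_assoc]

lemma IsBastonPower.apply_eq {u : QSpace n → EReal} {k : ℕ} {T T' : RadonCurrent n}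
    (hT : IsBastonPower u k T) (hT' : IsBastonPower u k T') {η : Form n} (hη : IsTestForm η) :
    T.apply η = T'.apply η := by
  induction k generalizing T T' η with
  | zero => exact (hT η hη).trans (hT' η hη).symm
  | succ k ih =>
    obtain ⟨S, hS, hST⟩ := hT
    obtain ⟨S', hS', hST'⟩ := hT'
    rw [hST.2 η hη, hST'.2 η hη]
    exact RadonCurrent.mulApply_eq_of_apply_eq (fun _ h => ih hS hS' h) u _

lemma IsMongeAmpereMeasure.unique {u : QSpace n → EReal} {μ ν : Measure (QSpace n)}
    (hμ : IsMongeAmpereMeasure u μ) (hν : IsMongeAmpereMeasure u ν) : μ = ν := by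
  obtain ⟨_, T, hT, hTμ⟩ := hμ
  obtain ⟨_, T', hT', hTν⟩ := hν
  refine measure_eq_of_integral_contDiff_eq fun g hg hs => ?_
  have hη := isTestForm_singleForm ∅ hg hs
  have h := (hTμ _ hη).symm.trans ((hT.apply_eq hT' hη).trans (hTν _ hη))
  simp only [singleForm, Pi.single_eq_same] at h
  exact_mod_cast (integral_ofReal (𝕜 := ℂ)).symm.trans (h.trans integral_ofReal)

/-! ### The currents `(△u)^k` for `u = -1 / ‖q‖²` -/

lemma toReal_negInvNormSq (q : QSpace n) : (negInvNormSq n q).toReal = -regInv 0 q := by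
  unfold negInvNormSq regInv
  split_ifs with h
  · simp [h]
  · simp [neg_div]

/-- The current `(△u)^k`, `k < n`, for `u = -1 / ‖q‖²`. -/
def powCurrent {n k : ℕ} (hk : k < n) : RadonCurrent n where
  base := volume
  coeff I q := powVec k 0 q I
  locallyFinite := inferInstance
  locallyIntegrable I := by
    obtain ⟨C, -, h⟩ := exists_norm_powVec_le n k
    exact locallyIntegrable_eval (locallyIntegrable_of_norm_le_inv_norm_pow (p := 4 * k) volume
      (by rw [finrank_qSpace]; omega) (measurable_powVec k 0).aestronglyMeasurable (h 0 le_rfl)) I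

/-- The current `c δ₀ ω^0 ∧ … ∧ ω^{2n-1}`. -/
def diracCurrent (n : ℕ) (c : ℂ) : RadonCurrent n where
  base := Measure.dirac 0
  coeff I _ := if I = Finset.univ then c else 0
  locallyFinite := inferInstance
  locallyIntegrable _ := locallyIntegrable_const _

lemma diracCurrent_apply (c : ℂ) (η : Form n) : (diracCurrent n c).apply η = c * η ∅ 0 := by
  unfold RadonCurrent.apply pairing
  rw [Finset.sum_eq_single Finset.univ (fun I _ hI => by simp [diracCurrent, hI]) (by simp)]
  simp [diracCurrent, wedgeSign]

lemma powCurrent_mulApply {k : ℕ} (hk : k < n) (η : Form n) :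
    (powCurrent hk).mulApply (negInvNormSq n) η =
      pairing volume (fun I q => (-regInv 0 q • powVec k 0 q) I) η := by
  simp only [RadonCurrent.mulApply, toReal_negInvNormSq, powCurrent, Pi.smul_apply,
    Complex.real_smul]

lemma powCurrent_integrates {k : ℕ} (hk : k < n) :
    (powCurrent hk).Integrates (negInvNormSq n) := by
  have := nontrivial_qSpace (n := n) (by omega)
  refine fun I => ⟨?_, ?_⟩
  · filter_upwards [Measure.ae_ne volume 0] with q hq h
    simp [negInvNormSq, hq] at h
  · obtain ⟨C, h⟩ := exists_norm_regInv_smul_powVec_le n k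
    have hdens : (fun q => ((negInvNormSq n q).toReal : ℂ) * (powCurrent hk).coeff I q) =
        fun q => (-regInv 0 q • powVec k 0 q) I := by
      simp only [toReal_negInvNormSq, powCurrent, Pi.smul_apply, Complex.real_smul]
    rw [hdens]
    exact locallyIntegrable_eval (locallyIntegrable_of_norm_le_inv_norm_pow (p := 4 * k + 2)
      volume (by rw [finrank_qSpace]; omega)
      (measurable_regInv_smul_powVec k 0).aestronglyMeasurable (h 0 le_rfl)) I

lemma isBastonPower_powCurrent {k : ℕ} (hk : k < n) :
    IsBastonPower (negInvNormSq n) k (powCurrent hk) := by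
  induction k with
  | zero =>
    intro η _
    unfold RadonCurrent.apply pairing
    rw [Finset.sum_eq_single ∅ (fun I _ hI => by simp [powCurrent, powVec, hI]) (by simp)]
    simp [powCurrent, powVec, wedgeSign]
  | succ k ih =>
    refine ⟨powCurrent (by omega), ih _, powCurrent_integrates _, fun η hη => ?_⟩
    rw [powCurrent_mulApply]
    exact pairing_powVec_succ hk hη

lemma isBastonPower_diracCurrent (hn : 0 < n) :
    IsBastonPower (negInvNormSq n) n (diracCurrent n (maMass n)) := by
  obtain ⟨k, rfl⟩ := Nat.exists_eq_succ_of_ne_zero hn.ne'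
  refine ⟨powCurrent k.lt_succ_self, isBastonPower_powCurrent _, powCurrent_integrates _,
    fun η hη => ?_⟩
  rw [powCurrent_mulApply, diracCurrent_apply, pairing_regInv_smul_powVec_self hη]

lemma isMongeAmpereMeasure_negInvNormSq (hn : 0 < n) :
    IsMongeAmpereMeasure (negInvNormSq n) (ENNReal.ofReal (maMass n) • Measure.dirac 0) := by
  have hmass : 0 ≤ maMass n := by unfold maMass; positivity
  have : IsFiniteMeasure (ENNReal.ofReal (maMass n) • Measure.dirac (0 : QSpace n)) :=
    Measure.smul_finite _ ENNReal.ofReal_ne_top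
  refine ⟨inferInstance, _, isBastonPower_diracCurrent hn, fun η _ => ?_⟩
  rw [diracCurrent_apply, integral_smul_measure, integral_dirac, ENNReal.toReal_ofReal hmass,
    Complex.real_smul]

lemma isMongeAmpereMeasure_negInvNormSq_iff (hn : 0 < n) (μ : Measure (QSpace n)) :
    IsMongeAmpereMeasure (negInvNormSq n) μ ↔
      μ = ENNReal.ofReal (maMass n) • Measure.dirac 0 :=
  ⟨fun h => h.unique (isMongeAmpereMeasure_negInvNormSq hn),
    fun h => h ▸ isMongeAmpereMeasure_negInvNormSq hn⟩

end Currents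

/-! ### Spherical means of `1 / ‖q‖²` -/

lemma exists_orthonormalBasis_eq_norm_smul {E : Type*} [NormedAddCommGroup E]
    [InnerProductSpace ℝ E] [FiniteDimensional ℝ E] [Nontrivial E] (e : E) :
    ∃ i, ∃ b : OrthonormalBasis (Fin (Module.finrank ℝ E)) ℝ E, e = ‖e‖ • b i := by
  obtain ⟨u, hu, hue⟩ : ∃ u : E, ‖u‖ = 1 ∧ e = ‖e‖ • u := by
    rcases eq_or_ne e 0 with rfl | he
    · obtain ⟨u, hu⟩ := exists_norm_eq E zero_le_one
      exact ⟨u, hu, by simp⟩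
    · exact ⟨‖e‖⁻¹ • e, norm_smul_inv_norm he, (smul_inv_smul₀ (norm_ne_zero_iff.2 he) e).symm⟩
  let i : Fin (Module.finrank ℝ E) := ⟨0, Module.finrank_pos⟩
  obtain ⟨b, hb⟩ := Orthonormal.exists_orthonormalBasis_extension_of_card_eq
    (𝕜 := ℝ) (Fintype.card_fin _).symm (v := fun _ => u) (s := {i})
    ⟨fun _ => hu, fun _ _ hjk => (hjk (Subsingleton.elim _ _)).elim⟩
  exact ⟨i, b, by rw [hb i rfl, ← hue]⟩

section Sphere

variable {E : Type*} [NormedAddCommGroup E] [MeasurableSpace E] [BorelSpace E]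

lemma integral_mul_fun_norm_addHaar [NormedSpace ℝ E] [FiniteDimensional ℝ E] [Nontrivial E]
    (μ : Measure E) [μ.IsAddHaarMeasure] (f : E → ℝ) (h : ℝ → ℝ) :
    ∫ x, f (‖x‖⁻¹ • x) * h ‖x‖ ∂μ =
      (∫ ω, f ω.1 ∂μ.toSphere) * ∫ r in Set.Ioi 0, r ^ (Module.finrank ℝ E - 1) * h r := by
  calc ∫ x, f (‖x‖⁻¹ • x) * h ‖x‖ ∂μ
      = ∫ x : ({0}ᶜ : Set E), f (‖x.1‖⁻¹ • x.1) * h ‖x.1‖ ∂(μ.comap (↑)) := by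
        rw [integral_subtype_comap (measurableSet_singleton _).compl
          (fun x => f (‖x‖⁻¹ • x) * h ‖x‖), restrict_compl_singleton]
    _ = ∫ y, f y.1.1 * h y.2.1
          ∂μ.toSphere.prod (Measure.volumeIoiPow (Module.finrank ℝ E - 1)) := by
        simpa using μ.measurePreserving_homeomorphUnitSphereProd.integral_comp
          (Homeomorph.measurableEmbedding _)
          (fun y : Metric.sphere (0 : E) 1 × Set.Ioi (0 : ℝ) => f y.1.1 * h y.2.1)
    _ = (∫ ω, f ω.1 ∂μ.toSphere) *
          ∫ r : Set.Ioi (0 : ℝ), h r ∂Measure.volumeIoiPow (Module.finrank ℝ E - 1) :=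
        integral_prod_mul (fun ω : Metric.sphere (0 : E) 1 => f ω.1)
          (fun r : Set.Ioi (0 : ℝ) => h r.1)
    _ = _ := by
        congr 1
        simp only [Measure.volumeIoiPow, ENNReal.ofReal]
        rw [integral_withDensity_eq_integral_smul
            (measurable_subtype_coe.pow_const _).real_toNNReal,
          integral_subtype_comap measurableSet_Ioi
            fun a => Real.toNNReal (a ^ (Module.finrank ℝ E - 1)) • h a]
        refine setIntegral_congr_fun measurableSet_Ioi fun r hr => ?_
        simp only [NNReal.smul_def, Real.coe_toNNReal _ (pow_nonneg (le_of_lt hr) _), smul_eq_mul]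

lemma measurePreserving_neg_toSphere [NormedSpace ℝ E] (μ : Measure E) [μ.IsNegInvariant] :
    MeasurePreserving (fun ω : Metric.sphere (0 : E) 1 => -ω) μ.toSphere μ.toSphere := by
  refine ⟨continuous_neg.measurable, Measure.ext fun s hs => ?_⟩
  have himage : ((↑) '' ((fun ω : Metric.sphere (0 : E) 1 => -ω) ⁻¹' s) : Set E) =
      -((↑) '' s) := by
    ext x
    constructor
    · rintro ⟨ω, hω, rfl⟩
      exact ⟨-ω, hω, rfl⟩
    · rintro ⟨ω, hω, hx⟩
      exact ⟨-ω, by simpa using hω, by simp [hx]⟩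
  rw [Measure.map_apply continuous_neg.measurable hs, μ.toSphere_apply' hs,
    μ.toSphere_apply' (continuous_neg.measurable hs), himage, Set.smul_neg, Measure.measure_neg]

lemma Gamma_nat_add_one_half (k : ℕ) :
    Real.Gamma (k + 1 / 2) = k.centralBinom * k.factorial * √Real.pi / 4 ^ k := by
  induction k with
  | zero => simp [← Real.Gamma_one_half_eq]
  | succ k ih =>
    have hrec : ((k + 1 : ℕ) : ℝ) * (k + 1).centralBinom = 2 * (2 * k + 1) * k.centralBinom := by
      exact_mod_cast Nat.succ_mul_centralBinom_succ k
    have hshift : ((k + 1 : ℕ) : ℝ) + 1 / 2 = (k + 1 / 2 : ℝ) + 1 := by push_cast; ring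
    rw [hshift, Real.Gamma_add_one (by positivity), ih, Nat.factorial_succ, pow_succ]
    push_cast at hrec ⊢
    field_simp
    linear_combination -2 * hrec

lemma integral_Ioi_pow_mul_exp_neg_sq (m : ℕ) :
    ∫ r in Set.Ioi (0 : ℝ), r ^ m * Real.exp (-r ^ 2) = Real.Gamma ((m + 1) / 2) / 2 := by
  have h := integral_rpow_mul_exp_neg_rpow (p := 2) (q := m) two_pos
    (neg_one_lt_zero.trans_le m.cast_nonneg)
  simp only [Real.rpow_natCast, Real.rpow_two] at h
  rw [h]
  ring

lemma integral_pow_mul_exp_neg_sq (k : ℕ) :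
    ∫ x : ℝ, x ^ (2 * k) * Real.exp (-x ^ 2) = Real.Gamma (k + 1 / 2) := by
  have h := integral_comp_abs (f := fun x => x ^ (2 * k) * Real.exp (-x ^ 2))
  simp only [pow_mul, sq_abs] at h
  simp only [pow_mul]
  rw [h]
  simp only [← pow_mul]
  rw [integral_Ioi_pow_mul_exp_neg_sq]
  push_cast
  ring_nf

lemma integral_inner_pow_mul_exp_neg_norm_sq [InnerProductSpace ℝ E] [FiniteDimensional ℝ E]
    [Nontrivial E] (e : E) (k : ℕ) :
    ∫ x, inner ℝ e x ^ (2 * k) * Real.exp (-‖x‖ ^ 2) =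
      ‖e‖ ^ (2 * k) * (Real.Gamma (k + 1 / 2) * √Real.pi ^ (Module.finrank ℝ E - 1)) := by
  obtain ⟨i, b, hb⟩ := exists_orthonormalBasis_eq_norm_smul e
  have hpi (y : EuclideanSpace ℝ (Fin (Module.finrank ℝ E))) :
      y i ^ (2 * k) * Real.exp (-‖y‖ ^ 2) =
        ∏ j, y j ^ (if j = i then 2 * k else 0) * Real.exp (-y j ^ 2) := by
    rw [Finset.prod_mul_distrib, ← Real.exp_sum, Finset.sum_neg_distrib,
      EuclideanSpace.real_norm_sq_eq, Fintype.prod_eq_single i (by simp +contextual), if_pos rfl]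
  have hgauss : ∫ x : ℝ, Real.exp (-x ^ 2) = √Real.pi := by simpa using integral_gaussian 1
  calc ∫ x, inner ℝ e x ^ (2 * k) * Real.exp (-‖x‖ ^ 2)
      = ∫ x, ‖e‖ ^ (2 * k) * (b.repr x i ^ (2 * k) * Real.exp (-‖b.repr x‖ ^ 2)) := by
        refine integral_congr_ae (Eventually.of_forall fun x => ?_)
        simp only [b.repr_apply_apply, b.repr.norm_map]
        conv_lhs => rw [hb, real_inner_smul_left, mul_pow, mul_assoc]
    _ = ‖e‖ ^ (2 * k) * ∫ y : Fin (Module.finrank ℝ E) → ℝ,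
          ∏ j, y j ^ (if j = i then 2 * k else 0) * Real.exp (-y j ^ 2) := by
        rw [integral_const_mul, b.measurePreserving_repr.integral_comp
          b.repr.toHomeomorph.measurableEmbedding
          (fun y => y i ^ (2 * k) * Real.exp (-‖y‖ ^ 2)),
          ← (PiLp.volume_preserving_toLp _).integral_comp
            (MeasurableEquiv.toLp 2 _).measurableEmbedding]
        simp only [hpi]
    _ = _ := by
        rw [integral_fintype_prod_volume_eq_prod
            (fun j (t : ℝ) => t ^ (if j = i then 2 * k else 0) * Real.exp (-t ^ 2)),
          ← Finset.mul_prod_erase _ _ (Finset.mem_univ i), if_pos rfl,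
          integral_pow_mul_exp_neg_sq, Finset.prod_congr rfl fun j hj => by
            rw [if_neg (Finset.ne_of_mem_erase hj)]]
        simp [hgauss]

end Sphere

section QuaternionicSphere

lemma integral_inner_pow_toSphere (e : EuclideanSpace ℝ (Fin 4)) (k : ℕ) :
    ∫ ω, inner ℝ e ω.1 ^ (2 * k) ∂(volume : Measure (EuclideanSpace ℝ (Fin 4))).toSphere =
      2 * Real.pi ^ 2 * (catalan k * (‖e‖ ^ 2 / 4) ^ k) := by
  have hpolar := integral_mul_fun_norm_addHaar volume (fun x => inner ℝ e x ^ (2 * k))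
    (fun r => r ^ (2 * k) * Real.exp (-r ^ 2))
  have hscale (x : EuclideanSpace ℝ (Fin 4)) :
      inner ℝ e (‖x‖⁻¹ • x) ^ (2 * k) * (‖x‖ ^ (2 * k) * Real.exp (-‖x‖ ^ 2)) =
        inner ℝ e x ^ (2 * k) * Real.exp (-‖x‖ ^ 2) := by
    rw [← mul_assoc, ← mul_pow, mul_comm (inner ℝ e _), ← real_inner_smul_right, smul_smul]
    rcases eq_or_ne x 0 with rfl | hx
    · simp
    · rw [mul_inv_cancel₀ (norm_ne_zero_iff.2 hx), one_smul]
  have hradial : ∫ r in Set.Ioi (0 : ℝ), r ^ (4 - 1) * (r ^ (2 * k) * Real.exp (-r ^ 2)) =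
      (k + 1).factorial / 2 := by
    simp only [← mul_assoc, ← pow_add]
    have hdim : (((4 - 1 + 2 * k : ℕ) : ℝ) + 1) / 2 = (k + 1 : ℕ) + 1 := by push_cast; ring
    rw [integral_Ioi_pow_mul_exp_neg_sq, hdim, Real.Gamma_nat_eq_factorial]
  have hcatalan : (k + 1 : ℝ) * catalan k = k.centralBinom := by
    exact_mod_cast succ_mul_catalan_eq_centralBinom k
  have hpi : √Real.pi ^ 2 = Real.pi := Real.sq_sqrt Real.pi_pos.le
  simp only [hscale, finrank_euclideanSpace_fin] at hpolar
  rw [hradial, integral_inner_pow_mul_exp_neg_norm_sq, Gamma_nat_add_one_half, ← hcatalan,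
    finrank_euclideanSpace_fin, Nat.factorial_succ] at hpolar
  refine mul_right_cancel₀ (b := ((k + 1 : ℕ) * k.factorial : ℕ) / (2 : ℝ)) (by positivity)
    (hpolar.symm.trans ?_)
  calc ‖e‖ ^ (2 * k) * ((k + 1) * catalan k * k.factorial * √Real.pi / 4 ^ k *
        √Real.pi ^ (4 - 1))
      = ‖e‖ ^ (2 * k) * ((k + 1) * catalan k * k.factorial * (√Real.pi ^ 2) ^ 2 / 4 ^ k) := by
        ring
    _ = 2 * Real.pi ^ 2 * (catalan k * (‖e‖ ^ 2 / 4) ^ k) *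
        (((k + 1 : ℕ) * k.factorial : ℕ) / 2) := by
        rw [hpi, div_pow, ← pow_mul]
        push_cast
        ring

lemma measurePreserving_neg_sphereMeasure :
    MeasurePreserving (fun ω => -ω) sphereMeasure sphereMeasure :=
  (measurePreserving_neg_toSphere _).smul_measure _

lemma lintegral_inner_sq_pow_sphereMeasure (e : EuclideanSpace ℝ (Fin 4)) (k : ℕ) :
    ∫⁻ ω, ENNReal.ofReal (inner ℝ e ω.1 ^ 2) ^ k ∂sphereMeasure =
      catalan k * ENNReal.ofReal (‖e‖ ^ 2 / 4) ^ k := by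
  have hcont : Continuous fun ω : Metric.sphere (0 : EuclideanSpace ℝ (Fin 4)) 1 =>
    inner ℝ e ω.1 ^ (2 * k) := by fun_prop
  have huniv : (volume : Measure (EuclideanSpace ℝ (Fin 4))).toSphere Set.univ =
      ENNReal.ofReal (2 * Real.pi ^ 2) := by
    rw [← ofReal_measureReal]
    exact congrArg ENNReal.ofReal (by simpa using integral_inner_pow_toSphere 0 0)
  simp only [← ENNReal.ofReal_pow (sq_nonneg _), ← pow_mul]
  rw [sphereMeasure, lintegral_smul_measure, ← ofReal_integral_eq_lintegral_ofReal
    (hcont.integrable_of_hasCompactSupport (HasCompactSupport.of_compactSpace _))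
    (Eventually.of_forall fun ω => (even_two_mul k).pow_nonneg _), integral_inner_pow_toSphere,
    huniv, smul_eq_mul, ENNReal.ofReal_mul (p := 2 * Real.pi ^ 2) (by positivity),
    ENNReal.inv_mul_cancel_left (ENNReal.ofReal_pos.2 (by positivity)).ne' ENNReal.ofReal_ne_top,
    ENNReal.ofReal_mul (by positivity), ENNReal.ofReal_natCast,
    ENNReal.ofReal_pow (by positivity)]

lemma tsum_catalan_mul_pow_le {x y : ENNReal} (h : 1 + x * y ^ 2 ≤ y) :
    ∑' k, catalan k * x ^ k ≤ y := by
  refine ENNReal.tsum_le_of_sum_range_le fun N => ?_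
  induction N with
  | zero => simp
  | succ N ih =>
    set S := ∑ k ∈ Finset.range N, catalan k * x ^ k
    have hconv : ∑ k ∈ Finset.range N, ∑ p ∈ Finset.HasAntidiagonal.antidiagonal k,
        (catalan p.1 * x ^ p.1) * (catalan p.2 * x ^ p.2) ≤ S ^ 2 := by
      rw [sq, Finset.sum_mul_sum, ← Finset.sum_product', ← Finset.sum_biUnion]
      · refine Finset.sum_le_sum_of_subset fun p hp => ?_
        simp only [Finset.mem_biUnion, Finset.mem_range, Finset.HasAntidiagonal.mem_antidiagonal,
          Finset.mem_product] at hp ⊢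
        lia
      · refine fun k _ l _ hkl => Finset.disjoint_left.2 fun p hk hl => hkl ?_
        rw [← Finset.HasAntidiagonal.mem_antidiagonal.1 hk,
          Finset.HasAntidiagonal.mem_antidiagonal.1 hl]
    have hrec (k : ℕ) : (catalan (k + 1) : ENNReal) * x ^ (k + 1) =
        x * ∑ p ∈ Finset.HasAntidiagonal.antidiagonal k,
          (catalan p.1 * x ^ p.1) * (catalan p.2 * x ^ p.2) := by
      rw [catalan_succ', pow_succ', mul_left_comm]
      push_cast
      rw [Finset.sum_mul]
      refine congrArg (x * ·) (Finset.sum_congr rfl fun p hp => ?_)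
      rw [← Finset.HasAntidiagonal.mem_antidiagonal.1 hp, pow_add]
      ring
    calc ∑ k ∈ Finset.range (N + 1), catalan k * x ^ k
        = 1 + x * ∑ k ∈ Finset.range N, ∑ p ∈ Finset.HasAntidiagonal.antidiagonal k,
            (catalan p.1 * x ^ p.1) * (catalan p.2 * x ^ p.2) := by
          rw [Finset.sum_range_succ', add_comm, Finset.mul_sum]
          simp [hrec]
      _ ≤ 1 + x * y ^ 2 := by gcongr; exact hconv.trans (by gcongr)
      _ ≤ y := h

lemma inv_one_add_add_inv_one_sub {s : ℝ} (hs : |s| ≤ 1) :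
    (ENNReal.ofReal (1 + s))⁻¹ + (ENNReal.ofReal (1 - s))⁻¹ =
      2 * ∑' k, ENNReal.ofReal (s ^ 2) ^ k := by
  rw [ENNReal.tsum_geometric, ← ENNReal.ofReal_one, ← ENNReal.ofReal_sub _ (sq_nonneg s)]
  rcases hs.eq_or_lt with h | h
  · rcases (abs_eq zero_le_one).1 h with rfl | rfl <;> simp
  · obtain ⟨h1, h2⟩ := abs_lt.1 h
    have hplus : 0 < 1 + s := by linarith
    have hminus : 0 < 1 - s := by linarith
    have hprod : 1 - s ^ 2 = (1 + s) * (1 - s) := by ring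
    have : 0 < 1 - s ^ 2 := hprod ▸ mul_pos hplus hminus
    have htwo : (2 : ENNReal) = ENNReal.ofReal 2 := by simp
    rw [htwo, ← ENNReal.ofReal_inv_of_pos hplus, ← ENNReal.ofReal_inv_of_pos hminus,
      ← ENNReal.ofReal_inv_of_pos this, ← ENNReal.ofReal_add (by positivity) (by positivity),
      ← ENNReal.ofReal_mul zero_le_two, hprod]
    congr 1
    field_simp
    ring

lemma lintegral_inv_one_add_inner {e : EuclideanSpace ℝ (Fin 4)} (he : ‖e‖ ≤ 1) :
    ∫⁻ ω, (ENNReal.ofReal (1 + inner ℝ e ω.1))⁻¹ ∂sphereMeasure =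
      ∑' k, catalan k * ENNReal.ofReal (‖e‖ ^ 2 / 4) ^ k := by
  have hmeas : Measurable fun ω : Metric.sphere (0 : EuclideanSpace ℝ (Fin 4)) 1 =>
      (ENNReal.ofReal (1 + inner ℝ e ω.1))⁻¹ := by fun_prop
  have hanti := measurePreserving_neg_sphereMeasure.lintegral_comp hmeas
  have hinner (ω : Metric.sphere (0 : EuclideanSpace ℝ (Fin 4)) 1) : |inner ℝ e ω.1| ≤ 1 := by
    simpa using (abs_real_inner_le_norm e ω.1).trans (by simpa using he)
  refine (ENNReal.mul_right_inj two_ne_zero ENNReal.ofNat_ne_top).1 ?_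
  calc 2 * ∫⁻ ω, (ENNReal.ofReal (1 + inner ℝ e ω.1))⁻¹ ∂sphereMeasure
      = ∫⁻ ω, (ENNReal.ofReal (1 + inner ℝ e ω.1))⁻¹ +
          (ENNReal.ofReal (1 - inner ℝ e ω.1))⁻¹ ∂sphereMeasure := by
        rw [lintegral_add_left hmeas, two_mul]
        simp only [sub_eq_add_neg, ← inner_neg_right]
        exact congrArg _ hanti.symm
    _ = ∫⁻ ω, 2 * ∑' k, ENNReal.ofReal (inner ℝ e ω.1 ^ 2) ^ k ∂sphereMeasure :=
        lintegral_congr fun ω => inv_one_add_add_inv_one_sub (hinner ω)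
    _ = 2 * ∑' k, catalan k * ENNReal.ofReal (‖e‖ ^ 2 / 4) ^ k := by
        rw [lintegral_const_mul _ (by fun_prop), lintegral_tsum fun k => by fun_prop]
        simp only [lintegral_inner_sq_pow_sphereMeasure]

lemma exists_norm_add_sq_eq_mul_one_add_inner {E F : Type*} [NormedAddCommGroup E]
    [InnerProductSpace ℝ E] [CompleteSpace E] [NormedAddCommGroup F] [InnerProductSpace ℝ F]
    {p : F} (hp : p ≠ 0) (T : E →L[ℝ] F) {ρ : ℝ} (hρ : 0 ≤ ρ) (hT : ∀ x, ‖T x‖ = ρ * ‖x‖) :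
    ∃ e : E, ‖e‖ ≤ 2 * ‖p‖ * ρ / (‖p‖ ^ 2 + ρ ^ 2) ∧
      ∀ x, ‖x‖ = 1 → ‖p + T x‖ ^ 2 = (‖p‖ ^ 2 + ρ ^ 2) * (1 + inner ℝ e x) := by
  refine ⟨(2 / (‖p‖ ^ 2 + ρ ^ 2)) • (InnerProductSpace.toDual ℝ E).symm (innerSL ℝ p ∘L T),
    ?_, fun x hx => ?_⟩
  · rw [norm_smul, Real.norm_of_nonneg (by positivity), LinearIsometryEquiv.norm_map, mul_assoc,
      mul_div_right_comm]
    gcongr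
    refine ContinuousLinearMap.opNorm_le_bound _ (by positivity) fun x => ?_
    rw [mul_assoc, ← hT]
    exact norm_inner_le_norm p (T x)
  · simp only [real_inner_smul_left, InnerProductSpace.toDual_symm_apply,
      ContinuousLinearMap.comp_apply, innerSL_apply_apply]
    rw [norm_add_sq_real, hT, hx]
    field_simp
    ring

lemma lintegral_inv_norm_add_sq_le {F : Type*} [NormedAddCommGroup F] [InnerProductSpace ℝ F]
    (p : F) (T : EuclideanSpace ℝ (Fin 4) →L[ℝ] F) {ρ : ℝ} (hρ : 0 ≤ ρ)
    (hT : ∀ x, ‖T x‖ = ρ * ‖x‖) :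
    ∫⁻ ω, (ENNReal.ofReal (‖p + T ω.1‖ ^ 2))⁻¹ ∂sphereMeasure ≤
      (ENNReal.ofReal (‖p‖ ^ 2))⁻¹ := by
  rcases eq_or_ne p 0 with rfl | hp
  · simp
  obtain ⟨e, he, hexpand⟩ := exists_norm_add_sq_eq_mul_one_add_inner hp T hρ hT
  set A := ‖p‖ ^ 2 + ρ ^ 2 with hA
  have hApos : 0 < A := by positivity
  have hle : ‖e‖ ≤ 1 := he.trans ((div_le_one hApos).2 (two_mul_le_add_sq ‖p‖ ρ))
  have hfunctional : 1 + ENNReal.ofReal (‖e‖ ^ 2 / 4) * ENNReal.ofReal (A / ‖p‖ ^ 2) ^ 2 ≤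
      ENNReal.ofReal (A / ‖p‖ ^ 2) := by
    rw [← ENNReal.ofReal_one, ← ENNReal.ofReal_pow (by positivity),
      ← ENNReal.ofReal_mul (by positivity), ← ENNReal.ofReal_add zero_le_one (by positivity)]
    refine ENNReal.ofReal_le_ofReal ?_
    calc 1 + ‖e‖ ^ 2 / 4 * (A / ‖p‖ ^ 2) ^ 2
        ≤ 1 + (2 * ‖p‖ * ρ / A) ^ 2 / 4 * (A / ‖p‖ ^ 2) ^ 2 := by gcongr
      _ = A / ‖p‖ ^ 2 := by field_simp; rw [hA]; ring
  calc ∫⁻ ω, (ENNReal.ofReal (‖p + T ω.1‖ ^ 2))⁻¹ ∂sphereMeasure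
      = ∫⁻ ω, (ENNReal.ofReal A)⁻¹ * (ENNReal.ofReal (1 + inner ℝ e ω.1))⁻¹ ∂sphereMeasure := by
        refine lintegral_congr fun ω => ?_
        rw [hexpand ω.1 (norm_eq_of_mem_sphere ω), ENNReal.ofReal_mul hApos.le,
          ENNReal.mul_inv (.inl (ENNReal.ofReal_pos.2 hApos).ne') (.inl ENNReal.ofReal_ne_top)]
    _ = (ENNReal.ofReal A)⁻¹ * ∑' k, catalan k * ENNReal.ofReal (‖e‖ ^ 2 / 4) ^ k := by
        rw [lintegral_const_mul _ (by fun_prop), lintegral_inv_one_add_inner hle]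
    _ ≤ (ENNReal.ofReal A)⁻¹ * ENNReal.ofReal (A / ‖p‖ ^ 2) := by
        gcongr
        exact tsum_catalan_mul_pow_le hfunctional
    _ = (ENNReal.ofReal (‖p‖ ^ 2))⁻¹ := by
        rw [← ENNReal.ofReal_inv_of_pos hApos, ← ENNReal.ofReal_inv_of_pos (by positivity),
          ← ENNReal.ofReal_mul (by positivity)]
        congr 1
        field_simp

end QuaternionicSphere

lemma negInvNormSq_eq {n : ℕ} (q : QSpace n) :
    negInvNormSq n q = -(((ENNReal.ofReal (‖q‖ ^ 2))⁻¹ : ENNReal) : EReal) := by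
  unfold negInvNormSq
  split_ifs with h
  · simp [h]
  · have hq : 0 < ‖q‖ ^ 2 := by have := norm_pos_iff.2 h; positivity
    rw [← ENNReal.ofReal_inv_of_pos hq, EReal.coe_ennreal_ofReal, max_eq_left (by positivity),
      ← EReal.coe_neg]
    congr 1
    rw [neg_div, one_div]

lemma continuous_negInvNormSq (n : ℕ) : Continuous (negInvNormSq n) := by
  rw [funext negInvNormSq_eq]
  exact continuous_neg.comp (continuous_coe_ennreal_ereal.comp
    (continuous_inv.comp (ENNReal.continuous_ofReal.comp (by fun_prop))))

lemma negInvNormSq_ne_top {n : ℕ} (q : QSpace n) : negInvNormSq n q ≠ ⊤ := by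
  unfold negInvNormSq
  split_ifs <;> simp

lemma norm_ofQuat_sq {n : ℕ} (p : Fin n → ℍ[ℝ]) : ‖ofQuat p‖ ^ 2 = ∑ l, ‖p l‖ ^ 2 := by
  rw [EuclideanSpace.norm_sq_eq, Fintype.sum_prod_type]
  refine Finset.sum_congr rfl fun l _ => ?_
  rw [← Quaternion.linearIsometryEquivTuple.norm_map (p l), EuclideanSpace.norm_sq_eq]
  rfl

lemma ofQuat_add {n : ℕ} (p q : Fin n → ℍ[ℝ]) :
    ofQuat (fun l => p l + q l) = ofQuat p + ofQuat q := by
  ext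
  simp only [ofQuat, map_add]
  rfl

/-- The `ℝ`-linear parametrisation `t ↦ b t` of the right quaternionic line through `0` and `b`. -/
def rightLine {n : ℕ} (b : Fin n → ℍ[ℝ]) : ℍ[ℝ] →L[ℝ] QSpace n :=
  LinearMap.toContinuousLinearMap
    { toFun := fun t => ofQuat fun l => b l * t
      map_add' := fun s t => by simp only [mul_add, ofQuat_add]
      map_smul' := fun c t => by ext; simp [ofQuat] }

lemma ofQuat_add_mul {n : ℕ} (a b : Fin n → ℍ[ℝ]) (t : ℍ[ℝ]) :
    ofQuat (fun l => a l + b l * t) = ofQuat a + rightLine b t :=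
  ofQuat_add a fun l => b l * t

lemma norm_rightLine {n : ℕ} (b : Fin n → ℍ[ℝ]) (t : ℍ[ℝ]) :
    ‖rightLine b t‖ = ‖ofQuat b‖ * ‖t‖ := by
  rw [← sq_eq_sq₀ (norm_nonneg _) (by positivity), mul_pow, norm_ofQuat_sq]
  refine (norm_ofQuat_sq fun l => b l * t).trans ?_
  simp only [norm_mul, mul_pow, Finset.sum_mul]

lemma isSubharmonic_negInvNormSq_line {n : ℕ} (a b : Fin n → ℍ[ℝ]) :
    IsSubharmonic fun t => negInvNormSq n (ofQuat fun l => a l + b l * t) := by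
  simp only [ofQuat_add_mul]
  refine ⟨((continuous_negInvNormSq n).comp (by fun_prop)).upperSemicontinuous,
    fun _ => negInvNormSq_ne_top _, fun c r hr => ?_⟩
  let T : EuclideanSpace ℝ (Fin 4) →L[ℝ] QSpace n :=
    r • (rightLine b ∘L Quaternion.linearIsometryEquivTuple.symm.toContinuousLinearEquiv)
  have hT (x : EuclideanSpace ℝ (Fin 4)) : ‖T x‖ = r * ‖ofQuat b‖ * ‖x‖ := by
    change ‖r • rightLine b (Quaternion.linearIsometryEquivTuple.symm x)‖ = _
    rw [norm_smul, norm_rightLine, LinearIsometryEquiv.norm_map, Real.norm_of_nonneg hr.le,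
      mul_assoc]
  have hneg (x : ENNReal) : (-(x : EReal)).toENNReal = 0 :=
    EReal.toENNReal_of_nonpos (by simpa using EReal.coe_ennreal_nonneg x)
  have hmean := lintegral_inv_norm_add_sq_le (ofQuat a + rightLine b c) T (by positivity) hT
  simp only [sphereMean, negInvNormSq_eq, neg_neg, EReal.toENNReal_coe, hneg, lintegral_zero,
    EReal.coe_ennreal_zero, zero_sub, EReal.neg_le_neg_iff, EReal.coe_ennreal_le_coe_ennreal_iff,
    map_add, map_smul, ← add_assoc]
  exact hmean

lemma isPSH_negInvNormSq (n : ℕ) : IsPSH (negInvNormSq n) :=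
  ⟨(continuous_negInvNormSq n).upperSemicontinuous, negInvNormSq_ne_top,
    fun a b _ => isSubharmonic_negInvNormSq_line a b⟩

end QuaternionicMA

end

theorem proposition4p2 (n : ℕ) (hn : 0 < n) :
    QuaternionicMA.IsPSH (QuaternionicMA.negInvNormSq n) ∧
    ∀ μ : MeasureTheory.Measure (QuaternionicMA.QSpace n),
      QuaternionicMA.IsMongeAmpereMeasure (QuaternionicMA.negInvNormSq n) μ ↔
        μ = ENNReal.ofReal
            (8 ^ n * (n.factorial : ℝ) * Real.pi ^ (2 * n) / ((2 * n).factorial : ℝ)) •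
          MeasureTheory.Measure.dirac 0 :=
  ⟨QuaternionicMA.isPSH_negInvNormSq n, QuaternionicMA.isMongeAmpereMeasure_negInvNormSq_iff hn⟩
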